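/- Let $\mathcal C$ be a braided monoidal category with unit $I$ and braiding $c$. Monoidal products are written as juxtaposition, $1$ denotes identity morphisms, $g.f$ is the composite "first $f$, then $g$", and associativity and unit isomorphisms are suppressed. Let $\overline{\mathcal C}$ be the same monoidal category with the reverse braiding $\overline c_{X,Y}=c_{Y,X}^{-1}$. A *semigroup* in $\mathcal C$ is an object $A$ with an associative multiplication $m\colon AA\to A$; then $(A,m.c^{-1})$ is a semigroup in $\overline{\mathcal C}$. **Regular multiplier bimonoids.** A *multiplier bimonoid* $(A,t_1,t_2,e)$ in $\mathcal C$ consists of an object $A$, morphisms $t_1,t_2\colon AA\to AA$ and $e\colon A\to I$ such that $$1t_1.t_11=t_11.c^{-1}1.1t_1.c1.1t_1,\qquad 1e.t_1=1e,\qquad t_21.1t_2=1t_2.1c^{-1}.t_21.1c.t_21,\qquad e1.t_2=e1,$$ $$1t_1.t_21=t_21.1t_1,\qquad e1.t_1=1e.t_2 .$$ A *regular multiplier bimonoid* in $\mathcal C$ is a tuple $(A,t_1,t_2,t_3,t_4,e)$ such that $(A,t_1,t_2,e)$ is a multiplier bimonoid in $\mathcal C$, $(A,t_3,t_4,e)$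 is a multiplier bimonoid in $\overline{\mathcal C}$, and, with $m:=e1.t_1$, $$e1.t_1=e1.t_3.c,\quad 1m.c1.1t_1=1m.t_31.c1,\quad t_41.1t_1=1t_1.t_41,\quad m1.1c.t_21=m1.1t_4.1c,\quad 1t_3.t_21=t_21.1t_3 .$$ **The Catalan simplicial set** $\mathsf C$ has one 0-simplex $\ast$, two 1-simplices $s_0(\ast)$ and $\alpha$, exactly two non-degenerate 2-simplices, namely $\tau$ with all three faces $\alpha$ and $\varepsilon$ with $d_0\varepsilon=d_2\varepsilon=s_0(\ast)$ and $d_1\varepsilon=\alpha$, and for every $n>2$ every $n$-boundary has a unique filler. **The simplicial set** $\mathsf M_{12}$. It has one 0-simplex; its 1-simplices are the semigroups in $\mathcal C$. A 2-simplex with boundary $\{A_{12},A_{02},A_{01}\}$ (listing $d_0,d_1,d_2$) is a pair $(\varphi\,|\,\psi)$ of morphisms $\varphi\colon A_{02}A_{12}\to A_{01}A_{12}$ and $\psi\colon A_{01}A_{02}\to A_{01}A_{12}$ such that $$1m_{12}.\varphi1=\varphi.1m_{12},\quad \varphi.m_{02}1=m_{01}1.c^{-1}1.1\varphi.c1.1\varphi,$$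 $$m_{01}1.1\psi=\psi.m_{01}1,\quad \psi.1m_{02}=1m_{12}.1c^{-1}.\psi1.1c.\psi1,\quad m_{01}1.1\varphi=1m_{12}.\psi1 .$$ A 3-boundary $\{(\varphi_{123}|\psi_{123}),(\varphi_{023}|\psi_{023}),(\varphi_{013}|\psi_{013}),(\varphi_{012}|\psi_{012})\}$ has exactly one filler if $$1\varphi_{123}.\varphi_{013}1=\varphi_{012}1.c^{-1}1.1\varphi_{023}.c1.1\varphi_{123},\quad \psi_{012}1.1\psi_{023}=1\psi_{123}.1c^{-1}.\psi_{013}1.1c.\psi_{012}1,\quad \psi_{012}1.1\varphi_{023}=1\varphi_{123}.\psi_{013}1,$$ and no filler otherwise. For $n>3$ every $n$-boundary has exactly one filler. The degenerate 1-simplex is $I$, and for a semigroup $(A,m)$ one has $s_0(A,m)=(m\colon AA\to IA\,|\,1\colon IA\to IA)$ and $s_1(A,m)=(1\colon AI\to AI\,|\,m\colon AA\to AI)$. **The simplicial set** $\mathsf M_{34}$ has the same 0-simplex and 1-simplices as $\mathsf M_{12}$; its higher simplices and degeneracies are defined by the same formulas applied in $\overline{\mathcal C}$, that is, with $c$ replaced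 by $\overline c$ and the multiplication of each 1-simplex $(A,m)$ replaced by $m.c^{-1}$. **The simplicial set** $\mathsf M$. It has one 0-simplex; its 1-simplices are the semigroups in $\mathcal C$. A 2-simplex $(\varphi|\psi||\varphi'|\psi')$ consists of a 2-simplex $(\varphi|\psi)$ of $\mathsf M_{12}$ and a 2-simplex $(\varphi'|\psi')$ of $\mathsf M_{34}$ with common boundary $\{A_{12},A_{02},A_{01}\}$ such that $$m_{01}1.c^{-1}1.1\varphi=1m_{12}.\psi'1,\quad 1m_{12}.1c^{-1}.\psi1=m_{01}1.1\varphi',\quad 1m_{12}.c1.1\varphi=1m_{12}.\varphi'1.c1,\quad m_{01}1.1c.\psi1=m_{01}1.1\psi'.1c$$ as morphisms with domains $A_{01}A_{02}A_{12}$, $A_{01}A_{02}A_{12}$, $A_{12}A_{02}A_{12}$ and $A_{01}A_{02}A_{01}$, respectively. A 3-simplex consists of a 3-simplex of $\mathsf M_{12}$ and a 3-simplex of $\mathsf M_{34}$ such that corresponding faces form 2-simplices of $\mathsf M$ and $$\psi'_{012}1.1\varphi_{023}=1\varphi_{123}.\psi'_{013}1,\qquad 1\varphi'_{123}.\psi_{013}1=\psi_{012}1.1\varphi'_{023}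 .$$ For $n>3$ every $n$-boundary has exactly one filler; faces and degeneracies act memberwise. **Theorem.** $\mathsf M$ is a simplicial set, and there is a bijection between simplicial maps $\mathsf C\to\mathsf M$ and regular multiplier bimonoids in $\mathcal C$. Under it, $(A,t_1,t_2,t_3,t_4,e)$ corresponds to the simplicial map sending $\alpha$ to the semigroup $(A,\,m=e1.t_1)$, $\tau$ to $(t_1|t_2||t_3|t_4)$ and $\varepsilon$ to $(e|e||e|e)$. -/

import Mathlib

open CategoryTheory MonoidalCategory Simplicial

universe w v u

-- so that `⟶` elaborates to the standard hom instance of a category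
attribute [-instance] CategoryTheory.catToReflQuiver

namespace RegMult

section Constructions

variable {C : Type u} [Category.{v} C] [MonoidalCategory C]

/-- A semigroup in a monoidal category: an object with an associative multiplication. -/
structure SemigroupObj (C : Type u) [Category.{v} C] [MonoidalCategory C] where
  X : C
  mul : X ⊗ X ⟶ X
  assoc : mul ▷ X ≫ mul = (α_ X X X).hom ≫ X ◁ mul ≫ mul

/-- The monoidal unit as a trivial semigroup. -/
abbrev unitSemigroup (C : Type u) [Category.{v} C] [MonoidalCategory C] : SemigroupObj C where
  X := 𝟙_ C
  mul := (λ_ (𝟙_ C)).hom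
  assoc := by simp [unitors_equal]

/-- The semigroup with the same object and the twisted multiplication `m.c⁻¹`. -/
abbrev SemigroupObj.twist (b : BraidedCategory C) (S : SemigroupObj C) : SemigroupObj C where
  X := S.X
  mul := (b.braiding S.X S.X).inv ≫ S.mul
  assoc := by
    have y := congrArg Iso.inv (b.yang_baxter_iso S.X S.X S.X)
    simp only [Iso.trans_inv, Iso.symm_inv, whiskerRightIso_inv, whiskerLeftIso_inv,
      Category.assoc] at y
    have y' := congrArg (fun t => (α_ S.X S.X S.X).hom ≫ t) y
    simp only [Iso.hom_inv_id_assoc] at y'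
    simp [S.assoc, reassoc_of% y']

/-! ### Two-dimensional simplices -/

/-- 2-simplices of `M₁` with boundary `{A₁₂, A₀₂, A₀₁}`, for the braiding `b`:
`φ : A₀₂ A₁₂ ⟶ A₀₁ A₁₂` with `1m₁₂.φ1 = φ.1m₁₂` and
`φ.m₀₂1 = m₀₁1.c⁻¹1.1φ.c1.1φ` (associativity isomorphisms made explicit). -/
structure IsTriangle₁ (b : BraidedCategory C) (A₁₂ A₀₂ A₀₁ : SemigroupObj C)
    (φ : A₀₂.X ⊗ A₁₂.X ⟶ A₀₁.X ⊗ A₁₂.X) : Prop where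
  linear :
    φ ▷ A₁₂.X ≫ (α_ A₀₁.X A₁₂.X A₁₂.X).hom ≫ A₀₁.X ◁ A₁₂.mul =
      (α_ A₀₂.X A₁₂.X A₁₂.X).hom ≫ A₀₂.X ◁ A₁₂.mul ≫ φ
  multiplicative :
    A₀₂.mul ▷ A₁₂.X ≫ φ =
      (α_ A₀₂.X A₀₂.X A₁₂.X).hom ≫ A₀₂.X ◁ φ ≫
        (α_ A₀₂.X A₀₁.X A₁₂.X).inv ≫ (b.braiding A₀₂.X A₀₁.X).hom ▷ A₁₂.X ≫
        (α_ A₀₁.X A₀₂.X A₁₂.X).hom ≫ A₀₁.X ◁ φ ≫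
        (α_ A₀₁.X A₀₁.X A₁₂.X).inv ≫ (b.braiding A₀₁.X A₀₁.X).inv ▷ A₁₂.X ≫
        A₀₁.mul ▷ A₁₂.X

/-- 2-simplices of `M₂` with boundary `{A₁₂, A₀₂, A₀₁}`, for the braiding `b`:
`ψ : A₀₁ A₀₂ ⟶ A₀₁ A₁₂` with `m₀₁1.1ψ = ψ.m₀₁1` and
`ψ.1m₀₂ = 1m₁₂.1c⁻¹.ψ1.1c.ψ1`. -/
structure IsTriangle₂ (b : BraidedCategory C) (A₁₂ A₀₂ A₀₁ : SemigroupObj C)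
    (ψ : A₀₁.X ⊗ A₀₂.X ⟶ A₀₁.X ⊗ A₁₂.X) : Prop where
  linear :
    A₀₁.X ◁ ψ ≫ (α_ A₀₁.X A₀₁.X A₁₂.X).inv ≫ A₀₁.mul ▷ A₁₂.X =
      (α_ A₀₁.X A₀₁.X A₀₂.X).inv ≫ A₀₁.mul ▷ A₀₂.X ≫ ψ
  multiplicative :
    A₀₁.X ◁ A₀₂.mul ≫ ψ =
      (α_ A₀₁.X A₀₂.X A₀₂.X).inv ≫ ψ ▷ A₀₂.X ≫
        (α_ A₀₁.X A₁₂.X A₀₂.X).hom ≫ A₀₁.X ◁ (b.braiding A₁₂.X A₀₂.X).hom ≫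
        (α_ A₀₁.X A₀₂.X A₁₂.X).inv ≫ ψ ▷ A₁₂.X ≫
        (α_ A₀₁.X A₁₂.X A₁₂.X).hom ≫ A₀₁.X ◁ (b.braiding A₁₂.X A₁₂.X).inv ≫
        A₀₁.X ◁ A₁₂.mul

/-- 2-simplices `(φ | ψ)` of `M₁₂` with boundary `{A₁₂, A₀₂, A₀₁}`, for the braiding `b`.
The 2-simplices of `M₃₄` are obtained by using the reverse braiding and the twisted semigroups. -/
structure IsTriangle₁₂ (b : BraidedCategory C) (A₁₂ A₀₂ A₀₁ : SemigroupObj C)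
    (φ : A₀₂.X ⊗ A₁₂.X ⟶ A₀₁.X ⊗ A₁₂.X) (ψ : A₀₁.X ⊗ A₀₂.X ⟶ A₀₁.X ⊗ A₁₂.X) : Prop where
  left : IsTriangle₁ b A₁₂ A₀₂ A₀₁ φ
  right : IsTriangle₂ b A₁₂ A₀₂ A₀₁ ψ
  compat :
    A₀₁.X ◁ φ ≫ (α_ A₀₁.X A₀₁.X A₁₂.X).inv ≫ A₀₁.mul ▷ A₁₂.X =
      (α_ A₀₁.X A₀₂.X A₁₂.X).inv ≫ ψ ▷ A₁₂.X ≫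
        (α_ A₀₁.X A₁₂.X A₁₂.X).hom ≫ A₀₁.X ◁ A₁₂.mul

/-- The 2-simplices `(φ | ψ || φ' | ψ')` of `M` with boundary `{A₁₂, A₀₂, A₀₁}`: a 2-simplex of
`M₁₂` and a 2-simplex of `M₃₄` satisfying four compatibility conditions. -/
@[ext]
structure Filler [b : BraidedCategory C] (A₁₂ A₀₂ A₀₁ : SemigroupObj C) where
  φ : A₀₂.X ⊗ A₁₂.X ⟶ A₀₁.X ⊗ A₁₂.X
  ψ : A₀₁.X ⊗ A₀₂.X ⟶ A₀₁.X ⊗ A₁₂.X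
  φ' : A₀₂.X ⊗ A₁₂.X ⟶ A₀₁.X ⊗ A₁₂.X
  ψ' : A₀₁.X ⊗ A₀₂.X ⟶ A₀₁.X ⊗ A₁₂.X
  unprimed : IsTriangle₁₂ b A₁₂ A₀₂ A₀₁ φ ψ
  primed : IsTriangle₁₂ (reverseBraiding C) (A₁₂.twist b) (A₀₂.twist b) (A₀₁.twist b) φ' ψ'
  compat₁ :
    A₀₁.X ◁ φ ≫ (α_ A₀₁.X A₀₁.X A₁₂.X).inv ≫
        (β_ A₀₁.X A₀₁.X).inv ▷ A₁₂.X ≫ A₀₁.mul ▷ A₁₂.X =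
      (α_ A₀₁.X A₀₂.X A₁₂.X).inv ≫ ψ' ▷ A₁₂.X ≫
        (α_ A₀₁.X A₁₂.X A₁₂.X).hom ≫ A₀₁.X ◁ A₁₂.mul
  compat₂ :
    ψ ▷ A₁₂.X ≫ (α_ A₀₁.X A₁₂.X A₁₂.X).hom ≫
        A₀₁.X ◁ (β_ A₁₂.X A₁₂.X).inv ≫ A₀₁.X ◁ A₁₂.mul =
      (α_ A₀₁.X A₀₂.X A₁₂.X).hom ≫ A₀₁.X ◁ φ' ≫
        (α_ A₀₁.X A₀₁.X A₁₂.X).inv ≫ A₀₁.mul ▷ A₁₂.X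
  compat₃ :
    A₁₂.X ◁ φ ≫ (α_ A₁₂.X A₀₁.X A₁₂.X).inv ≫ (β_ A₁₂.X A₀₁.X).hom ▷ A₁₂.X ≫
        (α_ A₀₁.X A₁₂.X A₁₂.X).hom ≫ A₀₁.X ◁ A₁₂.mul =
      (α_ A₁₂.X A₀₂.X A₁₂.X).inv ≫ (β_ A₁₂.X A₀₂.X).hom ▷ A₁₂.X ≫ φ' ▷ A₁₂.X ≫
        (α_ A₀₁.X A₁₂.X A₁₂.X).hom ≫ A₀₁.X ◁ A₁₂.mul
  compat₄ :
    ψ ▷ A₀₁.X ≫ (α_ A₀₁.X A₁₂.X A₀₁.X).hom ≫ A₀₁.X ◁ (β_ A₁₂.X A₀₁.X).hom ≫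
        (α_ A₀₁.X A₀₁.X A₁₂.X).inv ≫ A₀₁.mul ▷ A₁₂.X =
      (α_ A₀₁.X A₀₂.X A₀₁.X).hom ≫ A₀₁.X ◁ (β_ A₀₂.X A₀₁.X).hom ≫ A₀₁.X ◁ ψ' ≫
        (α_ A₀₁.X A₀₁.X A₁₂.X).inv ≫ A₀₁.mul ▷ A₁₂.X

/-! ### Three-dimensional simplices -/

/-- The fusion equation
`1φ₁₂₃.φ₀₁₃1 = φ₀₁₂1.c⁻¹1.1φ₀₂₃.c1.1φ₁₂₃` on `A₀₃ A₁₃ A₂₃`, for the braiding `b`. -/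
def FusionEquation₁ (b : BraidedCategory C) {A₀₁ A₀₂ A₀₃ A₁₂ A₁₃ A₂₃ : C}
    (φ₁₂₃ : A₁₃ ⊗ A₂₃ ⟶ A₁₂ ⊗ A₂₃) (φ₀₂₃ : A₀₃ ⊗ A₂₃ ⟶ A₀₂ ⊗ A₂₃)
    (φ₀₁₃ : A₀₃ ⊗ A₁₃ ⟶ A₀₁ ⊗ A₁₃) (φ₀₁₂ : A₀₂ ⊗ A₁₂ ⟶ A₀₁ ⊗ A₁₂) : Prop :=
  φ₀₁₃ ▷ A₂₃ ≫ (α_ A₀₁ A₁₃ A₂₃).hom ≫ A₀₁ ◁ φ₁₂₃ =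
    (α_ A₀₃ A₁₃ A₂₃).hom ≫ A₀₃ ◁ φ₁₂₃ ≫
      (α_ A₀₃ A₁₂ A₂₃).inv ≫ (b.braiding A₀₃ A₁₂).hom ▷ A₂₃ ≫
      (α_ A₁₂ A₀₃ A₂₃).hom ≫ A₁₂ ◁ φ₀₂₃ ≫
      (α_ A₁₂ A₀₂ A₂₃).inv ≫ (b.braiding A₀₂ A₁₂).inv ▷ A₂₃ ≫
      φ₀₁₂ ▷ A₂₃ ≫ (α_ A₀₁ A₁₂ A₂₃).hom

/-- The fusion equation for the reversed monoidal product,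
`ψ₀₁₂1.1ψ₀₂₃ = 1ψ₁₂₃.1c⁻¹.ψ₀₁₃1.1c.ψ₀₁₂1` on `A₀₁ A₀₂ A₀₃`, for the braiding `b`. -/
def FusionEquation₂ (b : BraidedCategory C) {A₀₁ A₀₂ A₀₃ A₁₂ A₁₃ A₂₃ : C}
    (ψ₁₂₃ : A₁₂ ⊗ A₁₃ ⟶ A₁₂ ⊗ A₂₃) (ψ₀₂₃ : A₀₂ ⊗ A₀₃ ⟶ A₀₂ ⊗ A₂₃)
    (ψ₀₁₃ : A₀₁ ⊗ A₀₃ ⟶ A₀₁ ⊗ A₁₃) (ψ₀₁₂ : A₀₁ ⊗ A₀₂ ⟶ A₀₁ ⊗ A₁₂) : Prop :=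
  A₀₁ ◁ ψ₀₂₃ ≫ (α_ A₀₁ A₀₂ A₂₃).inv ≫ ψ₀₁₂ ▷ A₂₃ =
    (α_ A₀₁ A₀₂ A₀₃).inv ≫ ψ₀₁₂ ▷ A₀₃ ≫
      (α_ A₀₁ A₁₂ A₀₃).hom ≫ A₀₁ ◁ (b.braiding A₁₂ A₀₃).hom ≫
      (α_ A₀₁ A₀₃ A₁₂).inv ≫ ψ₀₁₃ ▷ A₁₂ ≫
      (α_ A₀₁ A₁₃ A₁₂).hom ≫ A₀₁ ◁ (b.braiding A₁₂ A₁₃).inv ≫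
      A₀₁ ◁ ψ₁₂₃ ≫ (α_ A₀₁ A₁₂ A₂₃).inv

/-- The equation `ψ₀₁₂1.1φ₀₂₃ = 1φ₁₂₃.ψ₀₁₃1` on `A₀₁ A₀₃ A₂₃`. -/
def Interchange {A₀₁ A₀₂ A₀₃ A₁₂ A₁₃ A₂₃ : C}
    (φ₁₂₃ : A₁₃ ⊗ A₂₃ ⟶ A₁₂ ⊗ A₂₃) (φ₀₂₃ : A₀₃ ⊗ A₂₃ ⟶ A₀₂ ⊗ A₂₃)
    (ψ₀₁₃ : A₀₁ ⊗ A₀₃ ⟶ A₀₁ ⊗ A₁₃) (ψ₀₁₂ : A₀₁ ⊗ A₀₂ ⟶ A₀₁ ⊗ A₁₂) : Prop :=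
  A₀₁ ◁ φ₀₂₃ ≫ (α_ A₀₁ A₀₂ A₂₃).inv ≫ ψ₀₁₂ ▷ A₂₃ =
    (α_ A₀₁ A₀₃ A₂₃).inv ≫ ψ₀₁₃ ▷ A₂₃ ≫ (α_ A₀₁ A₁₃ A₂₃).hom ≫ A₀₁ ◁ φ₁₂₃ ≫
      (α_ A₀₁ A₁₂ A₂₃).inv

/-- The condition for four morphisms `φ` and four morphisms `ψ` to be a 3-simplex of `M₁₂`, for the
braiding `b`; with the reverse braiding it is the condition for `M₃₄`. -/
structure IsTetrahedron₁₂ (b : BraidedCategory C) {A₀₁ A₀₂ A₀₃ A₁₂ A₁₃ A₂₃ : C}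
    (φ₁₂₃ : A₁₃ ⊗ A₂₃ ⟶ A₁₂ ⊗ A₂₃) (φ₀₂₃ : A₀₃ ⊗ A₂₃ ⟶ A₀₂ ⊗ A₂₃)
    (φ₀₁₃ : A₀₃ ⊗ A₁₃ ⟶ A₀₁ ⊗ A₁₃) (φ₀₁₂ : A₀₂ ⊗ A₁₂ ⟶ A₀₁ ⊗ A₁₂)
    (ψ₁₂₃ : A₁₂ ⊗ A₁₃ ⟶ A₁₂ ⊗ A₂₃) (ψ₀₂₃ : A₀₂ ⊗ A₀₃ ⟶ A₀₂ ⊗ A₂₃)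
    (ψ₀₁₃ : A₀₁ ⊗ A₀₃ ⟶ A₀₁ ⊗ A₁₃) (ψ₀₁₂ : A₀₁ ⊗ A₀₂ ⟶ A₀₁ ⊗ A₁₂) : Prop where
  left : FusionEquation₁ b φ₁₂₃ φ₀₂₃ φ₀₁₃ φ₀₁₂
  right : FusionEquation₂ b ψ₁₂₃ ψ₀₂₃ ψ₀₁₃ ψ₀₁₂
  interchange : Interchange φ₁₂₃ φ₀₂₃ ψ₀₁₃ ψ₀₁₂

/-- The condition for four 2-simplices of `M` forming a 3-boundary to have a (then unique) filler
in `M`. -/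
structure IsTetrahedron [b : BraidedCategory C] {A₀₁ A₀₂ A₀₃ A₁₂ A₁₃ A₂₃ : SemigroupObj C}
    (w₁₂₃ : Filler A₂₃ A₁₃ A₁₂) (w₀₂₃ : Filler A₂₃ A₀₃ A₀₂)
    (w₀₁₃ : Filler A₁₃ A₀₃ A₀₁) (w₀₁₂ : Filler A₁₂ A₀₂ A₀₁) : Prop where
  unprimed : IsTetrahedron₁₂ b w₁₂₃.φ w₀₂₃.φ w₀₁₃.φ w₀₁₂.φ w₁₂₃.ψ w₀₂₃.ψ w₀₁₃.ψ w₀₁₂.ψ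
  primed : IsTetrahedron₁₂ (reverseBraiding C)
    w₁₂₃.φ' w₀₂₃.φ' w₀₁₃.φ' w₀₁₂.φ' w₁₂₃.ψ' w₀₂₃.ψ' w₀₁₃.ψ' w₀₁₂.ψ'
  interchange₁ : Interchange w₁₂₃.φ w₀₂₃.φ w₀₁₃.ψ' w₀₁₂.ψ'
  interchange₂ : Interchange w₁₂₃.φ' w₀₂₃.φ' w₀₁₃.ψ w₀₁₂.ψ

/-! ### Degenerate simplices -/

lemma isTriangle₁₂_degen₀ (b : BraidedCategory C) (A : SemigroupObj C)
    (l : 𝟙_ C ⊗ 𝟙_ C ⟶ 𝟙_ C) (hl : l = (λ_ (𝟙_ C)).hom)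
    (assoc : l ▷ 𝟙_ C ≫ l = (α_ (𝟙_ C) (𝟙_ C) (𝟙_ C)).hom ≫ 𝟙_ C ◁ l ≫ l) :
    IsTriangle₁₂ b A A ⟨𝟙_ C, l, assoc⟩ (A.mul ≫ (λ_ A.X).inv) (𝟙 (𝟙_ C ⊗ A.X)) := by
  subst hl
  have h := A.assoc
  refine ⟨⟨?_, ?_⟩, ⟨?_, ?_⟩, ?_⟩ <;> simp
  all_goals simp [reassoc_of% h]

lemma isTriangle₁₂_degen₁ (b : BraidedCategory C) (A : SemigroupObj C)
    (l : 𝟙_ C ⊗ 𝟙_ C ⟶ 𝟙_ C) (hl : l = (λ_ (𝟙_ C)).hom)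
    (assoc : l ▷ 𝟙_ C ≫ l = (α_ (𝟙_ C) (𝟙_ C) (𝟙_ C)).hom ≫ 𝟙_ C ◁ l ≫ l) :
    IsTriangle₁₂ b ⟨𝟙_ C, l, assoc⟩ A A (𝟙 (A.X ⊗ 𝟙_ C)) (A.mul ≫ (ρ_ A.X).inv) := by
  subst hl
  have h := A.assoc
  refine ⟨⟨?_, ?_⟩, ⟨?_, ?_⟩, ?_⟩ <;> simp
  all_goals simp [reassoc_of% h]

lemma braiding_unit_inv_comp (b : BraidedCategory C) :
    (b.braiding (𝟙_ C) (𝟙_ C)).inv ≫ (λ_ (𝟙_ C)).hom = (λ_ (𝟙_ C)).hom := by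
  simp [unitors_equal]

lemma IsTriangle₁.fusion_degen₀ {b : BraidedCategory C} {A₁₂ A₀₂ A₀₁ : SemigroupObj C}
    {φ : A₀₂.X ⊗ A₁₂.X ⟶ A₀₁.X ⊗ A₁₂.X} (h : IsTriangle₁ b A₁₂ A₀₂ A₀₁ φ) :
    FusionEquation₁ b φ φ (A₀₂.mul ≫ (λ_ A₀₂.X).inv) (A₀₁.mul ≫ (λ_ A₀₁.X).inv) := by
  have h' := h.multiplicative =≫ (λ_ (A₀₁.X ⊗ A₁₂.X)).inv
  simp only [Category.assoc] at h'
  simp [FusionEquation₁]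
  simpa using h'

lemma IsTriangle₁.fusion_degen₁ {b : BraidedCategory C} {A₁₂ A₀₂ A₀₁ : SemigroupObj C}
    {φ : A₀₂.X ⊗ A₁₂.X ⟶ A₀₁.X ⊗ A₁₂.X} (h : IsTriangle₁ b A₁₂ A₀₂ A₀₁ φ) :
    FusionEquation₁ b (A₁₂.mul ≫ (λ_ A₁₂.X).inv) φ φ (𝟙 (A₀₁.X ⊗ 𝟙_ C)) := by
  have h' := h.linear
  simp [FusionEquation₁]
  simp [reassoc_of% h']

lemma IsTriangle₂.fusion_degen₁ {b : BraidedCategory C} {A₁₂ A₀₂ A₀₁ : SemigroupObj C}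
    {ψ : A₀₁.X ⊗ A₀₂.X ⟶ A₀₁.X ⊗ A₁₂.X} (h : IsTriangle₂ b A₁₂ A₀₂ A₀₁ ψ) :
    FusionEquation₂ b (𝟙 (𝟙_ C ⊗ A₁₂.X)) ψ ψ (A₀₁.mul ≫ (ρ_ A₀₁.X).inv) := by
  have h' := h.linear
  simp [FusionEquation₂]
  simp [reassoc_of% h']

lemma IsTriangle₂.fusion_degen₂ {b : BraidedCategory C} {A₁₂ A₀₂ A₀₁ : SemigroupObj C}
    {ψ : A₀₁.X ⊗ A₀₂.X ⟶ A₀₁.X ⊗ A₁₂.X} (h : IsTriangle₂ b A₁₂ A₀₂ A₀₁ ψ) :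
    FusionEquation₂ b (A₁₂.mul ≫ (ρ_ A₁₂.X).inv) (A₀₂.mul ≫ (ρ_ A₀₂.X).inv) ψ ψ := by
  have h' := h.multiplicative =≫ (ρ_ (A₀₁.X ⊗ A₁₂.X)).inv
  simp only [Category.assoc] at h'
  simp [FusionEquation₂]
  simpa using h'

lemma FusionEquation₁.degen₂ (b : BraidedCategory C) {A₁₂ A₀₂ A₀₁ : C}
    (φ : A₀₂ ⊗ A₁₂ ⟶ A₀₁ ⊗ A₁₂) :
    FusionEquation₁ b (𝟙 (A₁₂ ⊗ 𝟙_ C)) (𝟙 (A₀₂ ⊗ 𝟙_ C)) φ φ := by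
  simp [FusionEquation₁]

lemma FusionEquation₂.degen₀ (b : BraidedCategory C) {A₁₂ A₀₂ A₀₁ : C}
    (ψ : A₀₁ ⊗ A₀₂ ⟶ A₀₁ ⊗ A₁₂) :
    FusionEquation₂ b ψ ψ (𝟙 (𝟙_ C ⊗ A₀₂)) (𝟙 (𝟙_ C ⊗ A₀₁)) := by
  simp [FusionEquation₂]

lemma Interchange.degen₀ {A₁₂ A₀₂ A₀₁ : C} (φ : A₀₂ ⊗ A₁₂ ⟶ A₀₁ ⊗ A₁₂) :
    Interchange φ φ (𝟙 (𝟙_ C ⊗ A₀₂)) (𝟙 (𝟙_ C ⊗ A₀₁)) := by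
  simp [Interchange]

lemma Interchange.degen₂ {A₁₂ A₀₂ A₀₁ : C} (ψ : A₀₁ ⊗ A₀₂ ⟶ A₀₁ ⊗ A₁₂) :
    Interchange (𝟙 (A₁₂ ⊗ 𝟙_ C)) (𝟙 (A₀₂ ⊗ 𝟙_ C)) ψ ψ := by
  simp [Interchange]

lemma Interchange.degen₁ {A₁₂ A₀₂ A₀₁ : C} {φ : A₀₂ ⊗ A₁₂ ⟶ A₀₁ ⊗ A₁₂}
    {ψ : A₀₁ ⊗ A₀₂ ⟶ A₀₁ ⊗ A₁₂} {m₀₁ : A₀₁ ⊗ A₀₁ ⟶ A₀₁} {m₁₂ : A₁₂ ⊗ A₁₂ ⟶ A₁₂}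
    (h : A₀₁ ◁ φ ≫ (α_ A₀₁ A₀₁ A₁₂).inv ≫ m₀₁ ▷ A₁₂ =
      (α_ A₀₁ A₀₂ A₁₂).inv ≫ ψ ▷ A₁₂ ≫ (α_ A₀₁ A₁₂ A₁₂).hom ≫ A₀₁ ◁ m₁₂) :
    Interchange (m₁₂ ≫ (λ_ A₁₂).inv) φ ψ (m₀₁ ≫ (ρ_ A₀₁).inv) := by
  simp [Interchange]
  simp [reassoc_of% h]

variable [b : BraidedCategory C]

/-- The degenerate 2-simplex `s₀(A)` of `M`. -/
def degen₀ (A : SemigroupObj C) : Filler A A (unitSemigroup C) where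
  φ := A.mul ≫ (λ_ A.X).inv
  ψ := 𝟙 _
  φ' := (A.twist b).mul ≫ (λ_ A.X).inv
  ψ' := 𝟙 _
  unprimed := isTriangle₁₂_degen₀ b A _ rfl _
  primed := isTriangle₁₂_degen₀ (reverseBraiding C) (A.twist b) _ (braiding_unit_inv_comp b) _
  compat₁ := by simp
  compat₂ := by simp
  compat₃ := by
    have h := A.assoc
    simp
    simp [reassoc_of% h]
  compat₄ := by simp

/-- The degenerate 2-simplex `s₁(A)` of `M`. -/
def degen₁ (A : SemigroupObj C) : Filler (unitSemigroup C) A A where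
  φ := 𝟙 _
  ψ := A.mul ≫ (ρ_ A.X).inv
  φ' := 𝟙 _
  ψ' := (A.twist b).mul ≫ (ρ_ A.X).inv
  unprimed := isTriangle₁₂_degen₁ b A _ rfl _
  primed := isTriangle₁₂_degen₁ (reverseBraiding C) (A.twist b) _ (braiding_unit_inv_comp b) _
  compat₁ := by simp
  compat₂ := by simp
  compat₃ := by simp
  compat₄ := by
    have h := A.assoc
    simp
    simp [reassoc_of% h]

lemma isTetrahedron_degen₀ {A₁₂ A₀₂ A₀₁ : SemigroupObj C} (w : Filler A₁₂ A₀₂ A₀₁) :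
    IsTetrahedron w w (degen₀ A₀₂) (degen₀ A₀₁) where
  unprimed := ⟨w.unprimed.left.fusion_degen₀,
    FusionEquation₂.degen₀ _ _, Interchange.degen₀ _⟩
  primed := ⟨w.primed.left.fusion_degen₀,
    FusionEquation₂.degen₀ _ _, Interchange.degen₀ _⟩
  interchange₁ := Interchange.degen₀ _
  interchange₂ := Interchange.degen₀ _

lemma isTetrahedron_degen₁ {A₁₂ A₀₂ A₀₁ : SemigroupObj C} (w : Filler A₁₂ A₀₂ A₀₁) :
    IsTetrahedron (degen₀ A₁₂) w w (degen₁ A₀₁) where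
  unprimed := ⟨w.unprimed.left.fusion_degen₁,
    w.unprimed.right.fusion_degen₁, Interchange.degen₁ w.unprimed.compat⟩
  primed := ⟨w.primed.left.fusion_degen₁,
    w.primed.right.fusion_degen₁, Interchange.degen₁ w.primed.compat⟩
  interchange₁ := Interchange.degen₁ (by simpa using w.compat₁)
  interchange₂ := Interchange.degen₁ (by
    have h := w.compat₂
    simp
    simp [h])

lemma isTetrahedron_degen₂ {A₁₂ A₀₂ A₀₁ : SemigroupObj C} (w : Filler A₁₂ A₀₂ A₀₁) :
    IsTetrahedron (degen₁ A₁₂) (degen₁ A₀₂) w w where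
  unprimed := ⟨FusionEquation₁.degen₂ _ _,
    w.unprimed.right.fusion_degen₂, Interchange.degen₂ _⟩
  primed := ⟨FusionEquation₁.degen₂ _ _,
    w.primed.right.fusion_degen₂, Interchange.degen₂ _⟩
  interchange₁ := Interchange.degen₂ _
  interchange₂ := Interchange.degen₂ _

/-! ### The simplicial set `M` -/

/-- A 2-simplex of `M` together with its boundary. -/
structure Triangle (C : Type u) [Category.{v} C] [MonoidalCategory C] [BraidedCategory C] where
  (A₁₂ A₀₂ A₀₁ : SemigroupObj C)
  filler : Filler A₁₂ A₀₂ A₀₁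

/-- The `n`-simplices of `M`. There is one 0-simplex, the 1-simplices are the semigroups, the
2-simplices are the `Filler`s, a 3-simplex is a 3-boundary of 2-simplices satisfying
`IsTetrahedron`, and higher simplices are generated coskeletally. So an `n`-simplex amounts to
its 1-dimensional faces `edge i j` and its 2-dimensional faces `face i j k`, such that all the
3-boundaries `i < j < k < l` have a filler; `edge i j` and `face i j k` are also given for
repeated indices, where they are required to be degenerate. -/
structure MSimplex (C : Type u) [Category.{v} C] [MonoidalCategory C] [BraidedCategory C]
    (n : ℕ) where
  edge (i j : Fin (n + 1)) (hij : i ≤ j) : SemigroupObj C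
  face (i j k : Fin (n + 1)) (hij : i ≤ j) (hjk : j ≤ k) :
    Filler (edge j k hjk) (edge i k (hij.trans hjk)) (edge i j hij)
  edge_self (i : Fin (n + 1)) : edge i i le_rfl = unitSemigroup C
  face_left (i k : Fin (n + 1)) (hik : i ≤ k) :
    Triangle.mk _ _ _ (face i i k le_rfl hik) = Triangle.mk _ _ _ (degen₀ (edge i k hik))
  face_right (i k : Fin (n + 1)) (hik : i ≤ k) :
    Triangle.mk _ _ _ (face i k k hik le_rfl) = Triangle.mk _ _ _ (degen₁ (edge i k hik))
  tetrahedron (i j k l : Fin (n + 1)) (hij : i < j) (hjk : j < k) (hkl : k < l) :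
    IsTetrahedron (face j k l hjk.le hkl.le) (face i k l (hij.trans hjk).le hkl.le)
      (face i j l hij.le (hjk.trans hkl).le) (face i j k hij.le hjk.le)

namespace MSimplex

variable {n : ℕ}

/-- Degenerate 3-boundaries have fillers. -/
lemma tetrahedron_of_le (x : MSimplex C n) (i j k l : Fin (n + 1))
    (hij : i ≤ j) (hjk : j ≤ k) (hkl : k ≤ l) :
    IsTetrahedron (x.face j k l hjk hkl) (x.face i k l (hij.trans hjk) hkl)
      (x.face i j l hij (hjk.trans hkl)) (x.face i j k hij hjk) := by
  rcases hij.eq_or_lt with rfl | hij'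
  · have key : ∀ {U V : SemigroupObj C} (p : Filler (x.edge i l (hjk.trans hkl))
        (x.edge i l (hjk.trans hkl)) U) (q : Filler (x.edge i k hjk) (x.edge i k hjk) V),
        Triangle.mk _ _ _ p = Triangle.mk _ _ _ (degen₀ (x.edge i l (hjk.trans hkl))) →
        Triangle.mk _ _ _ q = Triangle.mk _ _ _ (degen₀ (x.edge i k hjk)) → ∀ hUV : U = V,
        IsTetrahedron (x.face i k l hjk hkl) (x.face i k l hjk hkl) p (hUV ▸ q) := by
      intro U V p q hp hq hUV
      subst hUV
      simp only [Triangle.mk.injEq, true_and] at hp hq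
      obtain ⟨rfl, hp⟩ := hp
      obtain rfl := eq_of_heq hp
      obtain rfl := eq_of_heq hq.2
      exact isTetrahedron_degen₀ _
    exact key _ _ (x.face_left i l _) (x.face_left i k _) rfl
  rcases hjk.eq_or_lt with rfl | hjk'
  · have key : ∀ {U : SemigroupObj C}
        (p : Filler (x.edge j l hkl) (x.edge j l hkl) U)
        (q : Filler U (x.edge i j hij) (x.edge i j hij)),
        Triangle.mk _ _ _ p = Triangle.mk _ _ _ (degen₀ (x.edge j l hkl)) →
        Triangle.mk _ _ _ q = Triangle.mk _ _ _ (degen₁ (x.edge i j hij)) →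
        IsTetrahedron p (x.face i j l hij hkl) (x.face i j l hij hkl) q := by
      intro U p q hp hq
      simp only [Triangle.mk.injEq, true_and] at hp hq
      obtain ⟨rfl, hp⟩ := hp
      obtain rfl := eq_of_heq hp
      obtain rfl := eq_of_heq hq.2
      exact isTetrahedron_degen₁ _
    exact key _ _ (x.face_left j l _) (x.face_right i j _)
  rcases hkl.eq_or_lt with rfl | hkl'
  · have key : ∀ {U : SemigroupObj C}
        (p : Filler U (x.edge j k hjk) (x.edge j k hjk))
        (q : Filler U (x.edge i k (hij.trans hjk)) (x.edge i k (hij.trans hjk))),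
        Triangle.mk _ _ _ p = Triangle.mk _ _ _ (degen₁ (x.edge j k hjk)) →
        Triangle.mk _ _ _ q = Triangle.mk _ _ _ (degen₁ (x.edge i k (hij.trans hjk))) →
        IsTetrahedron p q (x.face i j k hij hjk) (x.face i j k hij hjk) := by
      intro U p q hp hq
      simp only [Triangle.mk.injEq, true_and] at hp hq
      obtain ⟨rfl, hp⟩ := hp
      obtain rfl := eq_of_heq hp
      obtain rfl := eq_of_heq hq.2
      exact isTetrahedron_degen₂ _
    exact key _ _ (x.face_right j k _) (x.face_right i k _)
  exact x.tetrahedron i j k l hij' hjk' hkl'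

/-- The simplicial operator induced by an order preserving map. -/
def pullback {m : ℕ} (x : MSimplex C n) (g : Fin (m + 1) →o Fin (n + 1)) : MSimplex C m where
  edge i j hij := x.edge (g i) (g j) (g.monotone hij)
  face i j k hij hjk := x.face (g i) (g j) (g k) (g.monotone hij) (g.monotone hjk)
  edge_self i := x.edge_self (g i)
  face_left i k hik := x.face_left (g i) (g k) (g.monotone hik)
  face_right i k hik := x.face_right (g i) (g k) (g.monotone hik)
  tetrahedron _ _ _ _ hij hjk hkl :=
    x.tetrahedron_of_le _ _ _ _ (g.monotone hij.le) (g.monotone hjk.le) (g.monotone hkl.le)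

end MSimplex

variable (C) in
/-- The simplicial set `M`. -/
def M : SSet.{max u v} where
  obj n := MSimplex C n.unop.len
  map g := ↾fun x => x.pullback g.unop.toOrderHom

end Constructions

/-! ### The Catalan simplicial set -/

/-- An `n`-simplex of the Catalan simplicial set, given by the set of those pairs of vertices
`i < j` for which the edge from `i` to `j` is the non-degenerate 1-simplex `α`; the only excluded
triangles are the ones in which the edge `0 ⟶ 2` is degenerate but one of the others is not.
The lemmas `pt_unique` to `existsUnique_filler` below identify the simplices up to dimension two
and show that all higher simplices are generated coskeletally. -/
@[ext]
structure CatalanSimplex (n : ℕ) : Type w where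
  rel : Fin (n + 1) → Fin (n + 1) → Prop
  lt_of_rel (i j : Fin (n + 1)) : rel i j → i < j
  rel_left (i j k : Fin (n + 1)) : rel i j → j ≤ k → rel i k
  rel_right (i j k : Fin (n + 1)) : i ≤ j → rel j k → rel i k

/-- The simplicial operator induced by an order preserving map. -/
def CatalanSimplex.pullback {n m : ℕ} (x : CatalanSimplex.{w} n)
    (g : Fin (m + 1) →o Fin (n + 1)) : CatalanSimplex.{w} m where
  rel i j := x.rel (g i) (g j)
  lt_of_rel _ _ h := g.monotone.reflect_lt (x.lt_of_rel _ _ h)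
  rel_left _ _ _ h hjk := x.rel_left _ _ _ h (g.monotone hjk)
  rel_right _ _ _ hij h := x.rel_right _ _ _ (g.monotone hij) h

/-- The Catalan simplicial set. -/
def catalan : SSet.{w} where
  obj n := CatalanSimplex.{w} n.unop.len
  map g := ↾fun x => x.pullback g.unop.toOrderHom

namespace catalan

/-- The unique 0-simplex. -/
def pt : catalan.{w} _⦋0⦌ where
  rel _ _ := False
  lt_of_rel _ _ h := h.elim
  rel_left _ _ _ h _ := h
  rel_right _ _ _ _ h := h

/-- The non-degenerate 1-simplex. -/
def α : catalan.{w} _⦋1⦌ where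
  rel i j := i < j
  lt_of_rel _ _ h := h
  rel_left _ _ _ h h' := h.trans_le h'
  rel_right _ _ _ h h' := h.trans_lt h'

/-- The non-degenerate 2-simplex with all faces `α`. -/
def τ : catalan.{w} _⦋2⦌ where
  rel i j := i < j
  lt_of_rel _ _ h := h
  rel_left _ _ _ h h' := h.trans_le h'
  rel_right _ _ _ h h' := h.trans_lt h'

/-- The non-degenerate 2-simplex with faces `s₀(pt)`, `α`, `s₀(pt)`. -/
def ε : catalan.{w} _⦋2⦌ where
  rel i j := i = 0 ∧ j = 2
  lt_of_rel i j h := by obtain ⟨rfl, rfl⟩ := h; decide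
  rel_left i j k h h' := by
    obtain ⟨rfl, rfl⟩ := h
    exact ⟨rfl, le_antisymm (Fin.le_last k) h'⟩
  rel_right i j k h h' := by
    obtain ⟨rfl, rfl⟩ := h'
    exact ⟨le_antisymm h (Fin.zero_le i), rfl⟩

lemma pt_unique (x : catalan.{w} _⦋0⦌) : x = pt := by
  apply CatalanSimplex.ext
  funext i j
  have : ¬ i < j := by have := Subsingleton.elim (α := Fin 1) i j; simp [this]
  exact propext ⟨fun h => this (x.lt_of_rel _ _ h), False.elim⟩

lemma rel_ext {n : ℕ} {x y : catalan.{w} _⦋n⦌}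
    (h : ∀ i j : Fin (n + 1), i < j →
      (CatalanSimplex.rel x i j ↔ CatalanSimplex.rel y i j)) : x = y := by
  apply CatalanSimplex.ext
  funext i j
  by_cases hij : i < j
  · exact propext (h i j hij)
  · exact propext ⟨fun h' => (hij (x.lt_of_rel _ _ h')).elim,
      fun h' => (hij (y.lt_of_rel _ _ h')).elim⟩

lemma edge_cases (x : catalan.{w} _⦋1⦌) : x = catalan.σ 0 pt ∨ x = α := by
  by_cases h : CatalanSimplex.rel x (0 : Fin 2) (1 : Fin 2)
  · right
    apply rel_ext
    intro i j hij
    fin_cases i <;> fin_cases j <;> simp_all [α]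
  · left
    apply rel_ext
    intro i j hij
    fin_cases i <;> fin_cases j <;> simp_all
    exact id

lemma α_ne : α.{w} ≠ catalan.σ 0 pt := fun h =>
  (congrArg (fun x : CatalanSimplex.{w} 1 => x.rel 0 1) h).mp (by decide : (0 : Fin 2) < 1)

lemma rel_δ {n : ℕ} (x : catalan.{w} _⦋n + 1⦌) (i : Fin (n + 2)) (a b : Fin (n + 1)) :
    CatalanSimplex.rel (catalan.δ i x) a b ↔
      CatalanSimplex.rel x (i.succAbove a) (i.succAbove b) := Iff.rfl

lemma rel_σ {n : ℕ} (x : catalan.{w} _⦋n⦌) (i : Fin (n + 1)) (a b : Fin (n + 2)) :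
    CatalanSimplex.rel (catalan.σ i x) a b ↔
      CatalanSimplex.rel x (i.predAbove a) (i.predAbove b) := Iff.rfl

lemma δ_τ (i : Fin 3) : catalan.δ i τ.{w} = α := by
  apply rel_ext
  intro a b _
  rw [rel_δ]
  exact (Fin.strictMono_succAbove i).lt_iff_lt

lemma δ_zero_ε : catalan.δ 0 ε.{w} = catalan.σ 0 pt := by
  apply rel_ext
  intro a b _
  rw [rel_δ, rel_σ]
  fin_cases a <;> fin_cases b <;> simp_all [ε, pt]

lemma δ_one_ε : catalan.δ 1 ε.{w} = α := by
  apply rel_ext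
  intro a b _
  rw [rel_δ]
  fin_cases a <;> fin_cases b <;> simp_all [ε, α]

lemma δ_two_ε : catalan.δ 2 ε.{w} = catalan.σ 0 pt := by
  apply rel_ext
  intro a b _
  rw [rel_δ, rel_σ]
  fin_cases a <;> fin_cases b <;> simp_all [ε, pt]

lemma triangle_cases (x : catalan.{w} _⦋2⦌) :
    x = catalan.σ 0 (catalan.σ 0 pt) ∨ x = catalan.σ 0 α ∨ x = catalan.σ 1 α ∨ x = τ ∨ x = ε := by
  have h1 : CatalanSimplex.rel x (0 : Fin 3) (1 : Fin 3) →
      CatalanSimplex.rel x (0 : Fin 3) (2 : Fin 3) := fun h => x.rel_left _ _ _ h (by decide)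
  have h2 : CatalanSimplex.rel x (1 : Fin 3) (2 : Fin 3) →
      CatalanSimplex.rel x (0 : Fin 3) (2 : Fin 3) := fun h => x.rel_right _ _ _ (by decide) h
  by_cases h01 : CatalanSimplex.rel x (0 : Fin 3) (1 : Fin 3) <;>
  by_cases h12 : CatalanSimplex.rel x (1 : Fin 3) (2 : Fin 3) <;>
  by_cases h02 : CatalanSimplex.rel x (0 : Fin 3) (2 : Fin 3) <;> try tauto
  · right; right; right; left
    apply rel_ext
    intro i j hij
    fin_cases i <;> fin_cases j <;> simp_all [τ]
  · right; right; left
    apply rel_ext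
    intro i j hij
    rw [rel_σ]
    fin_cases i <;> fin_cases j <;> simp_all [α, Fin.predAbove]
  · right; left
    apply rel_ext
    intro i j hij
    rw [rel_σ]
    fin_cases i <;> fin_cases j <;> simp_all [α, Fin.predAbove]
  · right; right; right; right
    apply rel_ext
    intro i j hij
    fin_cases i <;> fin_cases j <;> simp_all [ε]
  · left
    apply rel_ext
    intro i j hij
    rw [rel_σ, rel_σ]
    fin_cases i <;> fin_cases j <;> simp_all [pt]

/-- Every `n`-boundary with `n > 2` has a unique filler. -/
lemma existsUnique_filler {n : ℕ} (x : Fin (n + 4) → catalan.{w} _⦋n + 2⦌)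
    (hx : ∀ i j : Fin (n + 3), i ≤ j →
      catalan.δ i (x j.succ) = catalan.δ j (x i.castSucc)) :
    ∃! y : catalan.{w} _⦋n + 3⦌, ∀ i, catalan.δ i y = x i := by
  -- the value at a pair of vertices does not depend on the face through which it is read off
  have key : ∀ (i j : Fin (n + 4)) (a b a' b' : Fin (n + 3)),
      i.succAbove a = j.succAbove a' → i.succAbove b = j.succAbove b' →
      CatalanSimplex.rel (x i) a b → CatalanSimplex.rel (x j) a' b' := by
    have aux : ∀ (i j : Fin (n + 3)), i ≤ j → ∀ (a b a' b' : Fin (n + 3)),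
        i.castSucc.succAbove a = j.succ.succAbove a' →
        i.castSucc.succAbove b = j.succ.succAbove b' →
        (CatalanSimplex.rel (x i.castSucc) a b ↔ CatalanSimplex.rel (x j.succ) a' b') := by
      intro i j hij
      have one : ∀ a a' : Fin (n + 3), i.castSucc.succAbove a = j.succ.succAbove a' →
          ∃ c : Fin (n + 2), j.succAbove c = a ∧ i.succAbove c = a' := by
        intro a a' h
        have hne : a ≠ j := by
          rintro rfl
          rw [Fin.succAbove_castSucc_of_le _ _ hij] at h
          exact Fin.succAbove_ne _ _ h.symm
        obtain ⟨c, rfl⟩ := Fin.exists_succAbove_eq hne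
        refine ⟨c, rfl, ?_⟩
        apply Fin.succAbove_right_injective (p := j.succ)
        rw [← h]
        exact (DFunLike.congr_fun (congrArg SimplexCategory.Hom.toOrderHom
          (SimplexCategory.δ_comp_δ hij)) c)
      intro a b a' b' ha hb
      obtain ⟨c, rfl, rfl⟩ := one a a' ha
      obtain ⟨d, rfl, rfl⟩ := one b b' hb
      rw [← rel_δ, ← rel_δ, hx i j hij]
    intro i j a b a' b' ha hb h
    rcases lt_trichotomy i j with hij | rfl | hij
    · obtain ⟨i, rfl⟩ := Fin.exists_castSucc_eq.mpr (Fin.ne_last_of_lt hij)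
      obtain ⟨j, rfl⟩ := Fin.exists_succ_eq.mpr (Fin.ne_zero_of_lt hij)
      exact (aux i j (Fin.castSucc_lt_succ_iff.mp hij) _ _ _ _ ha hb).mp h
    · rwa [← Fin.succAbove_right_injective ha, ← Fin.succAbove_right_injective hb]
    · obtain ⟨j, rfl⟩ := Fin.exists_castSucc_eq.mpr (Fin.ne_last_of_lt hij)
      obtain ⟨i, rfl⟩ := Fin.exists_succ_eq.mpr (Fin.ne_zero_of_lt hij)
      exact (aux j i (Fin.castSucc_lt_succ_iff.mp hij) _ _ _ _ ha.symm hb.symm).mpr h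
  have avoid : ∀ a b c : Fin (n + 4), ∃ i : Fin (n + 4), a ≠ i ∧ b ≠ i ∧ c ≠ i := by
    intro a b c
    obtain ⟨i, hi⟩ : ∃ i, i ∉ ({a, b, c} : Finset (Fin (n + 4))) := by
      by_contra! h
      have h1 := Finset.card_le_card (fun i _ => h i : Finset.univ ⊆ ({a, b, c} : Finset _))
      have h2 := Finset.card_le_three (a := a) (b := b) (c := c)
      simp at h1
      omega
    refine ⟨i, ?_⟩
    simp only [Finset.mem_insert, Finset.mem_singleton, not_or] at hi
    exact ⟨Ne.symm hi.1, Ne.symm hi.2.1, Ne.symm hi.2.2⟩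
  let r : Fin (n + 4) → Fin (n + 4) → Prop := fun p q =>
    ∃ (i : Fin (n + 4)) (a b : Fin (n + 3)),
      i.succAbove a = p ∧ i.succAbove b = q ∧ CatalanSimplex.rel (x i) a b
  have hr : ∀ i a b, r (i.succAbove a) (i.succAbove b) ↔ CatalanSimplex.rel (x i) a b := by
    intro i a b
    exact ⟨fun ⟨j, c, d, hc, hd, h⟩ => key j i c d a b hc hd h, fun h => ⟨i, a, b, rfl, rfl, h⟩⟩
  refine ⟨⟨r, ?_, ?_, ?_⟩, ?_, ?_⟩
  · rintro _ _ ⟨i, a, b, rfl, rfl, h⟩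
    exact Fin.strictMono_succAbove i ((x i).lt_of_rel _ _ h)
  · intro p q s h hqs
    obtain ⟨i, hp, hq, hs⟩ := avoid p q s
    obtain ⟨a, rfl⟩ := Fin.exists_succAbove_eq hp
    obtain ⟨b, rfl⟩ := Fin.exists_succAbove_eq hq
    obtain ⟨c, rfl⟩ := Fin.exists_succAbove_eq hs
    rw [hr] at h ⊢
    exact (x i).rel_left _ _ _ h ((Fin.strictMono_succAbove i).le_iff_le.mp hqs)
  · intro p q s hpq h
    obtain ⟨i, hp, hq, hs⟩ := avoid p q s
    obtain ⟨a, rfl⟩ := Fin.exists_succAbove_eq hp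
    obtain ⟨b, rfl⟩ := Fin.exists_succAbove_eq hq
    obtain ⟨c, rfl⟩ := Fin.exists_succAbove_eq hs
    rw [hr] at h ⊢
    exact (x i).rel_right _ _ _ ((Fin.strictMono_succAbove i).le_iff_le.mp hpq) h
  · intro i
    apply rel_ext
    intro a b _
    exact hr i a b
  · intro y hy
    apply rel_ext
    intro p q _
    obtain ⟨i, hp, hq, _⟩ := avoid p q q
    obtain ⟨a, rfl⟩ := Fin.exists_succAbove_eq hp
    obtain ⟨b, rfl⟩ := Fin.exists_succAbove_eq hq
    rw [← rel_δ, hy i]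
    exact (hr i a b).symm

end catalan

/-! ### Regular multiplier bimonoids -/

section Bimonoids

variable {C : Type u} [Category.{v} C] [MonoidalCategory C]

/-- `t₁` is a fusion morphism for the braiding `b`, `t₂` is a fusion morphism for the reversed
monoidal product, `e` is a counit for both, and the two compatibility conditions
`1t₁.t₂1 = t₂1.1t₁` and `e1.t₁ = 1e.t₂` hold: that is, `(A, t₁, t₂, e)` is a multiplier bimonoid
with respect to the braiding `b`. -/
structure IsMultiplierBimonoid (b : BraidedCategory C) {A : C} (t₁ t₂ : A ⊗ A ⟶ A ⊗ A)
    (e : A ⟶ 𝟙_ C) : Prop where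
  fusion₁ : FusionEquation₁ b t₁ t₁ t₁ t₁
  counit₁ : t₁ ≫ A ◁ e = A ◁ e
  fusion₂ : FusionEquation₂ b t₂ t₂ t₂ t₂
  counit₂ : t₂ ≫ e ▷ A = e ▷ A
  interchange :
    (α_ A A A).inv ≫ t₂ ▷ A ≫ (α_ A A A).hom ≫ A ◁ t₁ =
      A ◁ t₁ ≫ (α_ A A A).inv ≫ t₂ ▷ A ≫ (α_ A A A).hom
  compat : t₁ ≫ e ▷ A ≫ (λ_ A).hom = t₂ ≫ A ◁ e ≫ (ρ_ A).hom

/-- A regular multiplier bimonoid in a braided monoidal category. -/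
structure RegularMultiplierBimonoid (C : Type u) [Category.{v} C] [MonoidalCategory C]
    [b : BraidedCategory C] where
  A : C
  (t₁ t₂ t₃ t₄ : A ⊗ A ⟶ A ⊗ A)
  e : A ⟶ 𝟙_ C
  unprimed : IsMultiplierBimonoid b t₁ t₂ e
  primed : IsMultiplierBimonoid (reverseBraiding C) t₃ t₄ e
  regular₁ : t₁ ≫ e ▷ A = (β_ A A).hom ≫ t₃ ≫ e ▷ A
  regular₂ :
    A ◁ t₁ ≫ (α_ A A A).inv ≫ (β_ A A).hom ▷ A ≫ (α_ A A A).hom ≫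
        A ◁ (t₁ ≫ e ▷ A ≫ (λ_ A).hom) =
      (α_ A A A).inv ≫ (β_ A A).hom ▷ A ≫ t₃ ▷ A ≫ (α_ A A A).hom ≫
        A ◁ (t₁ ≫ e ▷ A ≫ (λ_ A).hom)
  regular₃ :
    A ◁ t₁ ≫ (α_ A A A).inv ≫ t₄ ▷ A ≫ (α_ A A A).hom =
      (α_ A A A).inv ≫ t₄ ▷ A ≫ (α_ A A A).hom ≫ A ◁ t₁
  regular₄ :
    t₂ ▷ A ≫ (α_ A A A).hom ≫ A ◁ (β_ A A).hom ≫ (α_ A A A).inv ≫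
        (t₁ ≫ e ▷ A ≫ (λ_ A).hom) ▷ A =
      (α_ A A A).hom ≫ A ◁ (β_ A A).hom ≫ A ◁ t₄ ≫ (α_ A A A).inv ≫
        (t₁ ≫ e ▷ A ≫ (λ_ A).hom) ▷ A
  regular₅ :
    t₂ ▷ A ≫ (α_ A A A).hom ≫ A ◁ t₃ =
      (α_ A A A).hom ≫ A ◁ t₃ ≫ (α_ A A A).inv ≫ t₂ ▷ A ≫ (α_ A A A).hom

variable [BraidedCategory C]

/-- The multiplication `m = e1.t₁`, which is also the common diagonal of the first
regularity square. -/
def RegularMultiplierBimonoid.mul (R : RegularMultiplierBimonoid C) : R.A ⊗ R.A ⟶ R.A :=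
  R.t₁ ≫ R.e ▷ R.A ≫ (λ_ R.A).hom

/-- The simplicial map `f` corresponds to the regular multiplier bimonoid `R`: it sends `α` to the
semigroup `S = (A, m)`, it sends `τ` to `(t₁ | t₂ || t₃ | t₄)`, and it sends `ε` to
`(e | e || e | e)`, where `e : A ⟶ I` is regarded as a morphism `A I ⟶ I I` or `I A ⟶ I I`. -/
def Corresponds (f : catalan.{max u v} ⟶ M C) (R : RegularMultiplierBimonoid C) : Prop :=
  ∃ h : R.mul ▷ R.A ≫ R.mul = (α_ R.A R.A R.A).hom ≫ R.A ◁ R.mul ≫ R.mul,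
    let S : SemigroupObj C := ⟨R.A, R.mul, h⟩
    MSimplex.edge (f.app _ catalan.α) 0 1 (by decide) = S ∧
    (∃ w : Filler S S S,
      Triangle.mk _ _ _ (MSimplex.face (f.app _ catalan.τ) 0 1 2 (by decide) (by decide)) =
        Triangle.mk _ _ _ w ∧
      w.φ = R.t₁ ∧ w.ψ = R.t₂ ∧ w.φ' = R.t₃ ∧ w.ψ' = R.t₄) ∧
    ∃ w : Filler (unitSemigroup C) S (unitSemigroup C),
      Triangle.mk _ _ _ (MSimplex.face (f.app _ catalan.ε) 0 1 2 (by decide) (by decide)) =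
        Triangle.mk _ _ _ w ∧
      w.φ = R.e ▷ 𝟙_ C ∧ w.ψ = 𝟙_ C ◁ R.e ∧ w.φ' = R.e ▷ 𝟙_ C ∧ w.ψ' = 𝟙_ C ◁ R.e

end Bimonoids

end RegMult

/-!
A simplicial map from the Catalan simplicial set to `M` is determined by the images of the
non-degenerate simplices `α`, `τ` and `ε`, since every simplex of `M` is determined by its
2-dimensional faces (`RegMult.eq_of_value_eq`). Conversely, a semigroup `S`, a 2-simplex
`(t₁ | t₂ || t₃ | t₄)` with all faces `S` and a 2-simplex with boundary `{I, S, I}` extend to a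
simplicial map as soon as the images of the boundaries of the non-degenerate 3-simplices of the
Catalan simplicial set have fillers. There are four of these, recorded in `RegMult.CatalanData`;
the extension is `RegMult.CatalanData.toMap`.

A 2-simplex with boundary `{I, S, I}` is the same as a multiplicative morphism `e : S ⟶ I`
(`RegMult.exists_counit`, `RegMult.isTriangle₁₂_counit`). The four 3-simplices then express the
following:
* all edges `α`: the fusion equations and the interchange laws, including `regular₃` and `regular₅`;
* `01` and `12` degenerate: `e1.t₁ = m` and `e1.t₂ = e1`, together with their primed versions;
* `12` and `23` degenerate: `1e.t₁ = 1e` and `1e.t₂ = m`, together with their primed versions;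
* `01`, `12` and `23` degenerate: multiplicativity of `e`.

With `regular₂` and `regular₄`, which are two of the conditions on a 2-simplex of `M`, these include
all axioms of a regular multiplier bimonoid (`RegMult.exists_bimonoid`). In the other direction, the
remaining conditions on simplices of `M` have to be derived from the axioms. Associativity of `m`
and the conditions on `(t₁ | t₂ || t₃ | t₄)` follow by composing the fusion equations and the
interchange laws with `e` on one of the three tensor factors
(`RegMult.IsMultiplierBimonoid.linear₁` and the lemmas after it), and `e` is multiplicative by
composing `1e.t₁ = 1e` with `e`.
-/

namespace RegMult

section Algebra

variable {C : Type u} [Category.{v} C] [MonoidalCategory C]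

/-! ### Discarding a tensor factor along a counit -/

section Counit

variable {A X Y : C} (e : A ⟶ 𝟙_ C)

lemma whiskerLeft_comp_discard_left (f : X ⟶ Y) :
    A ◁ f ≫ e ▷ Y ≫ (λ_ Y).hom = e ▷ X ≫ (λ_ X).hom ≫ f := by
  rw [whisker_exchange_assoc, leftUnitor_naturality]

lemma whiskerRight_comp_discard_right (f : X ⟶ Y) :
    f ▷ A ≫ Y ◁ e ≫ (ρ_ Y).hom = X ◁ e ≫ (ρ_ X).hom ≫ f := by
  rw [← whisker_exchange_assoc, rightUnitor_naturality]

lemma discard_left_whiskerRight :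
    (e ▷ X ≫ (λ_ X).hom) ▷ Y = (α_ A X Y).hom ≫ e ▷ (X ⊗ Y) ≫ (λ_ (X ⊗ Y)).hom := by
  simp

lemma whiskerLeft_discard_right :
    X ◁ (Y ◁ e ≫ (ρ_ Y).hom) = (α_ X Y A).inv ≫ (X ⊗ Y) ◁ e ≫ (ρ_ (X ⊗ Y)).hom := by
  simp

lemma discard_middle :
    (X ◁ e ≫ (ρ_ X).hom) ▷ Y = (α_ X A Y).hom ≫ X ◁ (e ▷ Y ≫ (λ_ Y).hom) := by
  simp

lemma counit_comm :
    A ◁ e ≫ (ρ_ A).hom ≫ e = e ▷ A ≫ (λ_ A).hom ≫ e := by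
  rw [← leftUnitor_naturality, ← rightUnitor_naturality, whisker_exchange_assoc, unitors_equal]

variable (b : BraidedCategory C)

lemma braiding_comp_discard_left :
    (b.braiding X A).hom ≫ e ▷ X ≫ (λ_ X).hom = X ◁ e ≫ (ρ_ X).hom := by
  rw [← BraidedCategory.braiding_naturality_right_assoc, braiding_leftUnitor]

lemma braiding_comp_discard_right :
    (b.braiding A X).hom ≫ X ◁ e ≫ (ρ_ X).hom = e ▷ X ≫ (λ_ X).hom := by
  rw [← BraidedCategory.braiding_naturality_left_assoc, braiding_rightUnitor]

lemma braiding_inv_comp_discard_right :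
    (b.braiding X A).inv ≫ X ◁ e ≫ (ρ_ X).hom = e ▷ X ≫ (λ_ X).hom := by
  rw [← braiding_comp_discard_left, Iso.inv_hom_id_assoc]

lemma braiding_inv_comp_discard_left :
    (b.braiding A X).inv ≫ e ▷ X ≫ (λ_ X).hom = X ◁ e ≫ (ρ_ X).hom := by
  rw [← braiding_comp_discard_right, Iso.inv_hom_id_assoc]

end Counit

/-! ### The semigroup underlying a multiplier bimonoid -/

namespace IsMultiplierBimonoid

variable {b : BraidedCategory C} {A : C} {t₁ t₂ : A ⊗ A ⟶ A ⊗ A} {e : A ⟶ 𝟙_ C}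
  {m : A ⊗ A ⟶ A}

/-- Discarding the middle factor of the fusion equation. -/
lemma linear₁ (h : IsMultiplierBimonoid b t₁ t₂ e)
    (hm : t₁ ≫ e ▷ A ≫ (λ_ A).hom = m) :
    t₁ ▷ A ≫ (α_ A A A).hom ≫ A ◁ m = (α_ A A A).hom ≫ A ◁ m ≫ t₁ := by
  have hc : t₁ ≫ A ◁ e ≫ (ρ_ A).hom = A ◁ e ≫ (ρ_ A).hom := by
    rw [reassoc_of% h.counit₁]
  have hf := h.fusion₁ =≫ (A ◁ (e ▷ A ≫ (λ_ A).hom))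
  simp only [Category.assoc, ← discard_middle, ← whiskerLeft_comp, ← comp_whiskerRight, hc,
    braiding_inv_comp_discard_right] at hf
  simp only [discard_left_whiskerRight, Iso.inv_hom_id_assoc, hm,
    whiskerLeft_comp_discard_left] at hf
  simpa only [← reassoc_of% (discard_left_whiskerRight e (X := A) (Y := A)),
    ← comp_whiskerRight_assoc, braiding_comp_discard_left, discard_middle, Category.assoc,
    Iso.inv_hom_id_assoc, ← whiskerLeft_comp_assoc, hm] using hf

/-- Discarding the first factor of the fusion equation. -/
lemma multiplicative₁ (h : IsMultiplierBimonoid b t₁ t₂ e)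
    (hm : t₁ ≫ e ▷ A ≫ (λ_ A).hom = m) :
    m ▷ A ≫ t₁ =
      (α_ A A A).hom ≫ A ◁ t₁ ≫ (α_ A A A).inv ≫ (b.braiding A A).hom ▷ A ≫
        (α_ A A A).hom ≫ A ◁ t₁ ≫ (α_ A A A).inv ≫ (b.braiding A A).inv ▷ A ≫ m ▷ A := by
  have hf := h.fusion₁ =≫ (e ▷ (A ⊗ A) ≫ (λ_ _).hom)
  simp only [Category.assoc, whiskerLeft_comp_discard_left] at hf
  simpa only [← discard_left_whiskerRight, ← comp_whiskerRight, hm,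
    ← reassoc_of% (discard_left_whiskerRight e (X := A) (Y := A)),
    ← comp_whiskerRight_assoc] using hf

/-- Discarding the first factor of `linear₁`. -/
lemma assoc (h : IsMultiplierBimonoid b t₁ t₂ e)
    (hm : t₁ ≫ e ▷ A ≫ (λ_ A).hom = m) :
    m ▷ A ≫ m = (α_ A A A).hom ≫ A ◁ m ≫ m := by
  have hf := h.linear₁ hm =≫ (e ▷ A ≫ (λ_ _).hom)
  simp only [Category.assoc, hm, whiskerLeft_comp_discard_left] at hf
  simpa only [← reassoc_of% (discard_left_whiskerRight e (X := A) (Y := A)),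
    ← comp_whiskerRight_assoc, hm] using hf

/-- Discarding the middle factor of the second fusion equation. -/
lemma linear₂ (h : IsMultiplierBimonoid b t₁ t₂ e)
    (hm : t₂ ≫ A ◁ e ≫ (ρ_ A).hom = m) :
    A ◁ t₂ ≫ (α_ A A A).inv ≫ m ▷ A = (α_ A A A).inv ≫ m ▷ A ≫ t₂ := by
  have hc : t₂ ≫ e ▷ A ≫ (λ_ A).hom = e ▷ A ≫ (λ_ A).hom := by
    rw [reassoc_of% h.counit₂]
  have hf := h.fusion₂ =≫ ((A ◁ e ≫ (ρ_ A).hom) ▷ A)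
  simp only [← comp_whiskerRight, Category.assoc, hm] at hf
  simp only [discard_middle, Iso.inv_hom_id_assoc, ← whiskerLeft_comp, hc,
    braiding_inv_comp_discard_left] at hf
  simp only [whiskerLeft_discard_right, Iso.hom_inv_id_assoc,
    whiskerRight_comp_discard_right] at hf
  simpa only [← reassoc_of% (whiskerLeft_discard_right e (X := A) (Y := A)),
    ← whiskerLeft_comp_assoc, braiding_comp_discard_right,
    ← reassoc_of% (discard_middle e (X := A) (Y := A)), Category.assoc,
    ← comp_whiskerRight_assoc, hm] using hf

/-- Discarding the last factor of the second fusion equation. -/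
lemma multiplicative₂ (h : IsMultiplierBimonoid b t₁ t₂ e)
    (hm : t₂ ≫ A ◁ e ≫ (ρ_ A).hom = m) :
    A ◁ m ≫ t₂ =
      (α_ A A A).inv ≫ t₂ ▷ A ≫ (α_ A A A).hom ≫ A ◁ (b.braiding A A).hom ≫
        (α_ A A A).inv ≫ t₂ ▷ A ≫ (α_ A A A).hom ≫ A ◁ (b.braiding A A).inv ≫ A ◁ m := by
  have hf := h.fusion₂ =≫ ((A ⊗ A) ◁ e ≫ (ρ_ _).hom)
  simp only [Category.assoc, whiskerRight_comp_discard_right] at hf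
  simpa only [← whiskerLeft_discard_right, ← whiskerLeft_comp, hm,
    ← reassoc_of% (whiskerLeft_discard_right e (X := A) (Y := A)),
    ← whiskerLeft_comp_assoc] using hf

/-- The counit is multiplicative for `m = e1.t₁`: compose `1e.t₁ = 1e` with `e`. -/
lemma mul_comp_counit (h : IsMultiplierBimonoid b t₁ t₂ e)
    (hm : t₁ ≫ e ▷ A ≫ (λ_ A).hom = m) :
    m ≫ e = e ▷ A ≫ (λ_ A).hom ≫ e := by
  have hc := h.counit₁ =≫ (e ▷ 𝟙_ C ≫ (λ_ _).hom)
  simp only [Category.assoc, whiskerLeft_comp_discard_left] at hc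
  rw [← hm]
  simpa using hc

end IsMultiplierBimonoid

/-- Discarding the middle factor of an interchange law turns it into a compatibility condition of
2-simplices of `M`. The pairs `(t, t')` to be considered are `(t₁, t₂)`, `(t₃, t₄)`, `(t₁, t₄)` and
`(t₃, t₂)`. -/
lemma interchange_discard_middle {A : C} {t t' : A ⊗ A ⟶ A ⊗ A} {e : A ⟶ 𝟙_ C}
    {m m' : A ⊗ A ⟶ A}
    (hm : t ≫ e ▷ A ≫ (λ_ A).hom = m) (hm' : t' ≫ A ◁ e ≫ (ρ_ A).hom = m')
    (h : (α_ A A A).inv ≫ t' ▷ A ≫ (α_ A A A).hom ≫ A ◁ t =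
      A ◁ t ≫ (α_ A A A).inv ≫ t' ▷ A ≫ (α_ A A A).hom) :
    A ◁ t ≫ (α_ A A A).inv ≫ m' ▷ A =
      (α_ A A A).inv ≫ t' ▷ A ≫ (α_ A A A).hom ≫ A ◁ m := by
  have hf := h =≫ (A ◁ (e ▷ A ≫ (λ_ A).hom))
  simp only [Category.assoc, ← whiskerLeft_comp, hm] at hf
  simp only [← discard_middle, ← comp_whiskerRight, hm'] at hf
  exact hf.symm

/-! ### Simplices of `M` built from a counit -/

/-- The multiplication of the unit semigroup is a variable `l` because the twist of the unit
semigroup, whose multiplication equals `(λ_ (𝟙_ C)).hom` only propositionally, has to be covered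
too. -/
lemma isTriangle₁₂_counit (b : BraidedCategory C) (S : SemigroupObj C) (e : S.X ⟶ 𝟙_ C)
    (he : S.mul ≫ e = e ▷ S.X ≫ (λ_ S.X).hom ≫ e)
    (l : 𝟙_ C ⊗ 𝟙_ C ⟶ 𝟙_ C) (hl : l = (λ_ (𝟙_ C)).hom)
    (assoc : l ▷ 𝟙_ C ≫ l = (α_ (𝟙_ C) (𝟙_ C) (𝟙_ C)).hom ≫ 𝟙_ C ◁ l ≫ l) :
    IsTriangle₁₂ b ⟨𝟙_ C, l, assoc⟩ S ⟨𝟙_ C, l, assoc⟩ (e ▷ 𝟙_ C) (𝟙_ C ◁ e) := by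
  subst hl
  refine ⟨⟨?_, ?_⟩, ⟨?_, ?_⟩, ?_⟩
  · simp
    monoidal
  · simp [reassoc_of% he, reassoc_of% (counit_comm e)]
    monoidal
  · simp
    monoidal
  · simp [reassoc_of% he]
    monoidal
  · simp
    monoidal

/-! The names of the following lemmas refer to the tetrahedra `counit_left`, `counit_right` and
`counit_mul` of `CatalanData`. -/

section CounitTetrahedra

variable {b : BraidedCategory C} {A : C} {m : A ⊗ A ⟶ A} {t : A ⊗ A ⟶ A ⊗ A} {e : A ⟶ 𝟙_ C}

lemma fusionEquation₁_counit_left (ha : m ▷ A ≫ m = (α_ A A A).hom ≫ A ◁ m ≫ m)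
    (hm : t ≫ e ▷ A ≫ (λ_ A).hom = m) :
    FusionEquation₁ b (m ≫ (λ_ A).inv) t (m ≫ (λ_ A).inv) (e ▷ 𝟙_ C) := by
  have hm' : t ≫ e ▷ A = m ≫ (λ_ A).inv := by rw [← hm]; simp
  simp [FusionEquation₁]
  simp [reassoc_of% ha, reassoc_of% hm']

lemma fusionEquation₂_counit_left_iff :
    FusionEquation₂ b (𝟙 (𝟙_ C ⊗ A)) t (𝟙 (𝟙_ C ⊗ A)) (𝟙_ C ◁ e) ↔ t ≫ e ▷ A = e ▷ A := by
  simp [FusionEquation₂]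
  simp only [← Category.assoc, cancel_mono]

lemma interchange_counit_left_iff :
    Interchange (m ≫ (λ_ A).inv) t (𝟙 (𝟙_ C ⊗ A)) (𝟙_ C ◁ e) ↔
      t ≫ e ▷ A ≫ (λ_ A).hom = m := by
  simp [Interchange]
  have h : t ≫ e ▷ A ≫ (λ_ A).hom = m ↔ t ≫ e ▷ A = m ≫ (λ_ A).inv := by
    rw [Iso.eq_comp_inv, Category.assoc]
  rw [h]
  simp only [← Category.assoc, cancel_mono]

lemma fusionEquation₁_counit_right_iff :
    FusionEquation₁ b (e ▷ 𝟙_ C) (𝟙 (A ⊗ 𝟙_ C)) t (𝟙 (A ⊗ 𝟙_ C)) ↔ t ≫ A ◁ e = A ◁ e := by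
  simp [FusionEquation₁]
  simp only [← Category.assoc, cancel_mono]

lemma fusionEquation₂_counit_right (ha : m ▷ A ≫ m = (α_ A A A).hom ≫ A ◁ m ≫ m)
    (hm : t ≫ A ◁ e ≫ (ρ_ A).hom = m) :
    FusionEquation₂ b (𝟙_ C ◁ e) (m ≫ (ρ_ A).inv) t (m ≫ (ρ_ A).inv) := by
  have hm' : t ≫ A ◁ e = m ≫ (ρ_ A).inv := by rw [← hm]; simp
  simp [FusionEquation₂]
  simp [reassoc_of% ha, reassoc_of% hm']

lemma interchange_counit_right_iff :
    Interchange (e ▷ 𝟙_ C) (𝟙 (A ⊗ 𝟙_ C)) t (m ≫ (ρ_ A).inv) ↔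
      t ≫ A ◁ e ≫ (ρ_ A).hom = m := by
  simp [Interchange]
  rw [← Category.assoc, ← Iso.eq_comp_inv, eq_comm]

lemma fusionEquation₁_counit_mul (he : m ≫ e = e ▷ A ≫ (λ_ A).hom ≫ e) :
    FusionEquation₁ b (e ▷ 𝟙_ C) (𝟙 (A ⊗ 𝟙_ C)) (m ≫ (λ_ A).inv) (e ▷ 𝟙_ C) := by
  simp [FusionEquation₁]
  simp [reassoc_of% he, reassoc_of% (counit_comm e), unitors_inv_equal]

lemma fusionEquation₂_counit_mul (he : m ≫ e = e ▷ A ≫ (λ_ A).hom ≫ e) :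
    FusionEquation₂ b (𝟙_ C ◁ e) (m ≫ (ρ_ A).inv) (𝟙 (𝟙_ C ⊗ A)) (𝟙_ C ◁ e) := by
  simp [FusionEquation₂]
  simp [reassoc_of% he]
  monoidal

lemma interchange_counit_mul :
    Interchange (e ▷ 𝟙_ C) (𝟙 (A ⊗ 𝟙_ C)) (𝟙 (𝟙_ C ⊗ A)) (𝟙_ C ◁ e) := by
  simp [Interchange]

end CounitTetrahedra

end Algebra

section Correspondence

variable {C : Type u} [Category.{v} C] [MonoidalCategory C] [BraidedCategory C]

/-! ### Simplicial maps out of the Catalan simplicial set -/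

/-- The data of a simplicial map from the Catalan simplicial set to `M`: the images `S`, `mul` and
`counit` of the non-degenerate simplices `α`, `τ` and `ε`, such that the images of the boundaries of
the four non-degenerate 3-simplices have fillers. -/
structure CatalanData (C : Type u) [Category.{v} C] [MonoidalCategory C] [BraidedCategory C] where
  S : SemigroupObj C
  mul : Filler S S S
  counit : Filler (unitSemigroup C) S (unitSemigroup C)
  /-- The 3-simplex all of whose edges are `α`. -/
  fusion : IsTetrahedron mul mul mul mul
  /-- The 3-simplex in which the edges `01` and `12` are degenerate. -/
  counit_left : IsTetrahedron (degen₀ S) mul (degen₀ S) counit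
  /-- The 3-simplex in which the edges `12` and `23` are degenerate. -/
  counit_right : IsTetrahedron counit (degen₁ S) mul (degen₁ S)
  /-- The 3-simplex in which the edges `01`, `12` and `23` are degenerate. -/
  counit_mul : IsTetrahedron counit (degen₁ S) (degen₀ S) counit

namespace CatalanData

variable (D : CatalanData C)

/-- The 1-simplex of `M` assigned to an edge; `a` says whether the edge is `α`. -/
def edge (a : Bool) : SemigroupObj C := bif a then D.S else unitSemigroup C

/-- The 2-simplex of `M` assigned to a 2-simplex of the Catalan simplicial set; the three booleans
say which of the edges `12`, `02` and `01` are `α`. -/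
def face (a₁₂ a₀₂ a₀₁ : Bool) (h : a₁₂ = true → a₀₂ = true) (h' : a₀₁ = true → a₀₂ = true) :
    Filler (D.edge a₁₂) (D.edge a₀₂) (D.edge a₀₁) := by
  match a₁₂, a₀₂, a₀₁, h, h' with
  | true, true, true, _, _ => exact D.mul
  | true, true, false, _, _ => exact degen₀ D.S
  | false, true, true, _, _ => exact degen₁ D.S
  | false, true, false, _, _ => exact D.counit
  | false, false, false, _, _ => exact degen₀ (unitSemigroup C)
  | true, false, _, h, _ => exact absurd (h rfl) Bool.false_ne_true
  | false, false, true, _, h => exact absurd (h rfl) Bool.false_ne_true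

lemma degen₀_unit : degen₀ (unitSemigroup C) = degen₁ (unitSemigroup C) := by
  apply Filler.ext <;> simp [degen₀, degen₁, unitors_equal, unitors_inv_equal]

lemma face_left (a c : Bool) (hc : c = false) (h h') :
    Triangle.mk _ _ _ (D.face a a c h h') = Triangle.mk _ _ _ (degen₀ (D.edge a)) := by
  subst hc
  cases a <;> rfl

lemma face_right (a c : Bool) (hc : c = false) (h h') :
    Triangle.mk _ _ _ (D.face c a a h h') = Triangle.mk _ _ _ (degen₁ (D.edge a)) := by
  subst hc
  cases a
  · exact congrArg (Triangle.mk _ _ _) degen₀_unit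
  · rfl

lemma face_mul {a b c : Bool} (ha : a = true) (hb : b = true) (hc : c = true) {h h'} :
    Triangle.mk _ _ _ (D.face a b c h h') = Triangle.mk _ _ _ D.mul := by
  subst ha hb hc
  rfl

lemma face_counit {a b c : Bool} (ha : a = false) (hb : b = true) (hc : c = false) {h h'} :
    Triangle.mk _ _ _ (D.face a b c h h') = Triangle.mk _ _ _ D.counit := by
  subst ha hb hc
  rfl

/-- Among the fourteen 3-simplices of the Catalan simplicial set, four are non-degenerate and are
covered by the fields of `CatalanData`, while the others have degenerate images. -/
lemma isTetrahedron_face (a₀₁ a₀₂ a₀₃ a₁₂ a₁₃ a₂₃ : Bool)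
    (h₁₂₃ : a₂₃ = true → a₁₃ = true) (h₁₂₃' : a₁₂ = true → a₁₃ = true)
    (h₀₂₃ : a₂₃ = true → a₀₃ = true) (h₀₂₃' : a₀₂ = true → a₀₃ = true)
    (h₀₁₃ : a₁₃ = true → a₀₃ = true) (h₀₁₃' : a₀₁ = true → a₀₃ = true)
    (h₀₁₂ : a₁₂ = true → a₀₂ = true) (h₀₁₂' : a₀₁ = true → a₀₂ = true) :
    IsTetrahedron (D.face a₂₃ a₁₃ a₁₂ h₁₂₃ h₁₂₃') (D.face a₂₃ a₀₃ a₀₂ h₀₂₃ h₀₂₃')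
      (D.face a₁₃ a₀₃ a₀₁ h₀₁₃ h₀₁₃') (D.face a₁₂ a₀₂ a₀₁ h₀₁₂ h₀₁₂') := by
  cases a₀₁ <;> cases a₀₂ <;> cases a₀₃ <;> cases a₁₂ <;> cases a₁₃ <;> cases a₂₃ <;>
    simp only [reduceCtorEq, imp_false, imp_self, not_true_eq_false]
      at h₁₂₃ h₁₂₃' h₀₂₃ h₀₂₃' h₀₁₃ h₀₁₃' h₀₁₂ h₀₁₂'
  all_goals first
    | exact D.fusion
    | exact D.counit_left
    | exact D.counit_right
    | exact D.counit_mul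
    | exact isTetrahedron_degen₀ _
    | exact isTetrahedron_degen₁ _
    | exact isTetrahedron_degen₂ _
    -- `face` sends the constant triangle to `degen₀`, where the following two cases expect `degen₁`
    | (have h := isTetrahedron_degen₁ D.counit
       rw [← degen₀_unit] at h
       exact h)
    | (have h := isTetrahedron_degen₂ D.counit
       rw [← degen₀_unit] at h
       exact h)

open Classical in
/-- The simplex of `M` assigned to a simplex of the Catalan simplicial set. -/
noncomputable def simplex {n : ℕ} (x : CatalanSimplex.{w} n) : MSimplex C n where
  edge i j _ := D.edge (decide (x.rel i j))
  face i j k hij hjk := D.face (decide (x.rel j k)) (decide (x.rel i k)) (decide (x.rel i j))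
    (by simpa using x.rel_right i j k hij) (by simpa using fun h => x.rel_left i j k h hjk)
  edge_self i := by
    have h : ¬ x.rel i i := fun h => lt_irrefl _ (x.lt_of_rel i i h)
    simp [h, edge]
  face_left i k hik := D.face_left _ _ (by simpa using fun h => lt_irrefl _ (x.lt_of_rel i i h)) _ _
  face_right i k hik :=
    D.face_right _ _ (by simpa using fun h => lt_irrefl _ (x.lt_of_rel k k h)) _ _
  tetrahedron i j k l hij hjk hkl := D.isTetrahedron_face _ _ _ _ _ _ _ _ _ _ _ _ _ _

/-- The simplicial map sending `α` to `S`, `τ` to `mul` and `ε` to `counit`. -/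
noncomputable def toMap : catalan.{max u v} ⟶ M C where
  app _ := ↾fun x => D.simplex x
  naturality _ _ _ := rfl

end CatalanData

/-! ### The simplicial map of a regular multiplier bimonoid -/

namespace RegularMultiplierBimonoid

variable (R : RegularMultiplierBimonoid C)

lemma mul_assoc : R.mul ▷ R.A ≫ R.mul = (α_ R.A R.A R.A).hom ≫ R.A ◁ R.mul ≫ R.mul :=
  R.unprimed.assoc rfl

/-- The multiplication of the multiplier bimonoid `(A, t₃, t₄, e)` in the reverse braided category is
the twist of `m`. -/
lemma primed_mul :
    R.t₃ ≫ R.e ▷ R.A ≫ (λ_ R.A).hom = (β_ R.A R.A).inv ≫ R.mul := by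
  have h := R.regular₁ =≫ (λ_ R.A).hom
  simp only [Category.assoc] at h
  rw [mul, h, Iso.inv_hom_id_assoc]

/-- The semigroup `(A, m)`. -/
def semigroup : SemigroupObj C := ⟨R.A, R.mul, R.mul_assoc⟩

/-- The 2-simplex `(t₁ | t₂ || t₃ | t₄)` of `M`. -/
def mulFiller : Filler R.semigroup R.semigroup R.semigroup where
  φ := R.t₁
  ψ := R.t₂
  φ' := R.t₃
  ψ' := R.t₄
  unprimed := ⟨⟨R.unprimed.linear₁ rfl, R.unprimed.multiplicative₁ rfl⟩,
    ⟨R.unprimed.linear₂ R.unprimed.compat.symm, R.unprimed.multiplicative₂ R.unprimed.compat.symm⟩,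
    interchange_discard_middle rfl R.unprimed.compat.symm R.unprimed.interchange⟩
  primed :=
    have h₃ := R.primed_mul
    have h₄ := R.primed.compat.symm.trans h₃
    ⟨⟨R.primed.linear₁ h₃, R.primed.multiplicative₁ h₃⟩,
    ⟨R.primed.linear₂ h₄, R.primed.multiplicative₂ h₄⟩,
    interchange_discard_middle h₃ h₄ R.primed.interchange⟩
  compat₁ := by
    rw [← comp_whiskerRight]
    exact interchange_discard_middle rfl (R.primed.compat.symm.trans R.primed_mul) R.regular₃.symm
  compat₂ := by
    have h := R.regular₅
    rw [← Iso.inv_comp_eq] at h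
    rw [← Iso.inv_comp_eq, ← whiskerLeft_comp]
    exact (interchange_discard_middle R.primed_mul R.unprimed.compat.symm h).symm
  compat₃ := R.regular₂
  compat₄ := R.regular₄

/-- The 2-simplex `(e | e || e | e)` of `M`. -/
def counitFiller : Filler (unitSemigroup C) R.semigroup (unitSemigroup C) :=
  have he : R.mul ≫ R.e = R.e ▷ R.A ≫ (λ_ R.A).hom ≫ R.e := R.unprimed.mul_comp_counit rfl
  { φ := R.e ▷ 𝟙_ C
    ψ := 𝟙_ C ◁ R.e
    φ' := R.e ▷ 𝟙_ C
    ψ' := 𝟙_ C ◁ R.e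
    unprimed := isTriangle₁₂_counit _ _ _ he _ rfl _
    primed := isTriangle₁₂_counit _ _ _ (R.primed.mul_comp_counit R.primed_mul) _
      (braiding_unit_inv_comp _) _
    compat₁ := by simp; monoidal
    compat₂ := by simp; monoidal
    compat₃ := by simp; monoidal
    compat₄ := by simp }

lemma isTetrahedron_mulFiller :
    IsTetrahedron R.mulFiller R.mulFiller R.mulFiller R.mulFiller where
  unprimed := ⟨R.unprimed.fusion₁, R.unprimed.fusion₂, by
    have h := R.unprimed.interchange =≫ (α_ _ _ _).inv
    simp at h
    exact h.symm⟩
  primed := ⟨R.primed.fusion₁, R.primed.fusion₂, by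
    have h := R.primed.interchange =≫ (α_ _ _ _).inv
    simp at h
    exact h.symm⟩
  interchange₁ := by
    have h := R.regular₃ =≫ (α_ _ _ _).inv
    simp at h
    exact h
  interchange₂ := by
    have h := (α_ _ _ _).inv ≫= R.regular₅ =≫ (α_ _ _ _).inv
    simp at h
    exact h.symm

/-- The data of the simplicial map corresponding to a regular multiplier bimonoid. -/
def catalanData : CatalanData C where
  S := R.semigroup
  mul := R.mulFiller
  counit := R.counitFiller
  fusion := R.isTetrahedron_mulFiller
  counit_left := {
    unprimed := ⟨fusionEquation₁_counit_left R.mul_assoc rfl,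
      fusionEquation₂_counit_left_iff.2 R.unprimed.counit₂, interchange_counit_left_iff.2 rfl⟩
    primed := ⟨fusionEquation₁_counit_left (R.primed.assoc R.primed_mul) R.primed_mul,
      fusionEquation₂_counit_left_iff.2 R.primed.counit₂,
      interchange_counit_left_iff.2 R.primed_mul⟩
    interchange₁ := interchange_counit_left_iff.2 rfl
    interchange₂ := interchange_counit_left_iff.2 R.primed_mul }
  counit_right :=
    have h := R.unprimed.compat.symm
    have h' := R.primed.compat.symm.trans R.primed_mul
    { unprimed := ⟨fusionEquation₁_counit_right_iff.2 R.unprimed.counit₁,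
        fusionEquation₂_counit_right R.mul_assoc h, interchange_counit_right_iff.2 h⟩
      primed := ⟨fusionEquation₁_counit_right_iff.2 R.primed.counit₁,
        fusionEquation₂_counit_right (R.primed.assoc R.primed_mul) h',
        interchange_counit_right_iff.2 h'⟩
      interchange₁ := interchange_counit_right_iff.2 h'
      interchange₂ := interchange_counit_right_iff.2 h }
  counit_mul :=
    have h := R.unprimed.mul_comp_counit rfl
    have h' := R.primed.mul_comp_counit R.primed_mul
    { unprimed := ⟨fusionEquation₁_counit_mul h, fusionEquation₂_counit_mul h,
        interchange_counit_mul⟩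
      primed := ⟨fusionEquation₁_counit_mul h', fusionEquation₂_counit_mul h',
        interchange_counit_mul⟩
      interchange₁ := interchange_counit_mul
      interchange₂ := interchange_counit_mul }

lemma corresponds_toMap : Corresponds R.catalanData.toMap R := by
  -- `simplex` uses the classical decidability instances
  refine ⟨R.mul_assoc, ?_, ⟨R.mulFiller, ?_, rfl, rfl, rfl, rfl⟩,
    ⟨R.counitFiller, ?_, rfl, rfl, rfl, rfl⟩⟩
  · exact congrArg R.catalanData.edge (@decide_eq_true _ (Classical.propDecidable _) (by decide : (0 : Fin 2) < 1))
  · exact R.catalanData.face_mul (@decide_eq_true _ (Classical.propDecidable _) (by decide : (1 : Fin 3) < 2))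
      (@decide_eq_true _ (Classical.propDecidable _) (by decide : (0 : Fin 3) < 2))
      (@decide_eq_true _ (Classical.propDecidable _) (by decide : (0 : Fin 3) < 1))
  · exact R.catalanData.face_counit
      (@decide_eq_false _ (Classical.propDecidable _) (by decide : ¬ ((1 : Fin 3) = 0 ∧ (2 : Fin 3) = 2)))
      (@decide_eq_true _ (Classical.propDecidable _) (by decide : (0 : Fin 3) = 0 ∧ (2 : Fin 3) = 2))
      (@decide_eq_false _ (Classical.propDecidable _) (by decide : ¬ ((0 : Fin 3) = 0 ∧ (1 : Fin 3) = 2)))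

end RegularMultiplierBimonoid
/-! ### Simplices of `M` and their 2-dimensional faces -/

/-- The 2-dimensional face of a simplex on three vertices, together with its boundary. Equations
between 2-simplices are stated for `Triangle`s, since the types of their `Filler`s need not agree
definitionally. -/
def MSimplex.triangle {n : ℕ} (x : MSimplex C n) (i j k : Fin (n + 1)) (hij : i ≤ j)
    (hjk : j ≤ k) : Triangle C :=
  Triangle.mk _ _ _ (x.face i j k hij hjk)

lemma MSimplex.ext_triangle {n : ℕ} {x y : MSimplex C n}
    (h : ∀ i j k hij hjk, x.triangle i j k hij hjk = y.triangle i j k hij hjk) : x = y := by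
  have he : x.edge = y.edge := by
    funext i j hij
    exact congrArg Triangle.A₀₁ (h i j j hij le_rfl)
  obtain ⟨edge, face, _, _, _, _⟩ := x
  obtain ⟨edge', face', _, _, _, _⟩ := y
  obtain rfl : edge = edge' := he
  obtain rfl : face = face' := by
    funext i j k hij hjk
    have h' := h i j k hij hjk
    simp only [triangle, Triangle.mk.injEq, true_and] at h'
    exact eq_of_heq h'
  rfl

lemma IsTetrahedron.congr {A₀₁ A₀₂ A₀₃ A₁₂ A₁₃ A₂₃ B₀₁ B₀₂ B₀₃ B₁₂ B₁₃ B₂₃ : SemigroupObj C}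
    {w₁₂₃ : Filler A₂₃ A₁₃ A₁₂} {w₀₂₃ : Filler A₂₃ A₀₃ A₀₂}
    {w₀₁₃ : Filler A₁₃ A₀₃ A₀₁} {w₀₁₂ : Filler A₁₂ A₀₂ A₀₁}
    {v₁₂₃ : Filler B₂₃ B₁₃ B₁₂} {v₀₂₃ : Filler B₂₃ B₀₃ B₀₂}
    {v₀₁₃ : Filler B₁₃ B₀₃ B₀₁} {v₀₁₂ : Filler B₁₂ B₀₂ B₀₁}
    (h : IsTetrahedron w₁₂₃ w₀₂₃ w₀₁₃ w₀₁₂)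
    (h₁₂₃ : Triangle.mk _ _ _ w₁₂₃ = Triangle.mk _ _ _ v₁₂₃)
    (h₀₂₃ : Triangle.mk _ _ _ w₀₂₃ = Triangle.mk _ _ _ v₀₂₃)
    (h₀₁₃ : Triangle.mk _ _ _ w₀₁₃ = Triangle.mk _ _ _ v₀₁₃)
    (h₀₁₂ : Triangle.mk _ _ _ w₀₁₂ = Triangle.mk _ _ _ v₀₁₂) :
    IsTetrahedron v₁₂₃ v₀₂₃ v₀₁₃ v₀₁₂ := by
  cases h₁₂₃
  simp only [Triangle.mk.injEq, true_and] at h₀₂₃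
  obtain ⟨rfl, rfl, h₀₂₃⟩ := h₀₂₃
  obtain rfl := eq_of_heq h₀₂₃
  simp only [Triangle.mk.injEq, true_and] at h₀₁₃
  obtain ⟨rfl, h₀₁₃⟩ := h₀₁₃
  obtain rfl := eq_of_heq h₀₁₃
  simp only [Triangle.mk.injEq, true_and] at h₀₁₂
  obtain rfl := eq_of_heq h₀₁₂
  exact h

lemma Triangle.exists_filler (T : Triangle C) {S₁₂ S₀₂ S₀₁ : SemigroupObj C} (h₁₂ : T.A₁₂ = S₁₂)
    (h₀₂ : T.A₀₂ = S₀₂) (h₀₁ : T.A₀₁ = S₀₁) :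
    ∃ w : Filler S₁₂ S₀₂ S₀₁, T = Triangle.mk _ _ _ w := by
  subst h₁₂ h₀₂ h₀₁
  exact ⟨T.filler, rfl⟩

/-! ### The values of a simplicial map -/

section Maps

variable (f : catalan.{max u v} ⟶ M C)

/-- The image of a simplex of the Catalan simplicial set under a simplicial map. -/
def value {n : ℕ} (x : CatalanSimplex.{max u v} n) : MSimplex C n :=
  f.app (Opposite.op (SimplexCategory.mk n)) x

lemma value_pullback {n m : ℕ} (x : CatalanSimplex.{max u v} n)
    (g : Fin (m + 1) →o Fin (n + 1)) : value f (x.pullback g) = (value f x).pullback g :=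
  ConcreteCategory.congr_hom (f.naturality (SimplexCategory.mkHom g).op) x

/-- The order preserving map `⦋2⦌ ⟶ ⦋n⦌` with values `i ≤ j ≤ k`. -/
def vertices {n : ℕ} (i j k : Fin (n + 1)) (hij : i ≤ j) (hjk : j ≤ k) :
    Fin (2 + 1) →o Fin (n + 1) where
  toFun := ![i, j, k]
  monotone' := by
    rw [Fin.monotone_iff_le_succ]
    intro a
    fin_cases a
    · exact hij
    · exact hjk

lemma value_triangle {n : ℕ} (x : CatalanSimplex.{max u v} n) (i j k : Fin (n + 1))
    (hij : i ≤ j) (hjk : j ≤ k) :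
    (value f x).triangle i j k hij hjk = (value f (x.pullback (vertices i j k hij hjk))).triangle 0 1 2
      (by decide) (by decide) := by
  rw [value_pullback]
  rfl

/-- The 2-dimensional faces of the image of a simplex depend only on which edges of the
corresponding face are `α`. -/
lemma value_triangle_congr {n m : ℕ} {x : CatalanSimplex.{max u v} n}
    {y : CatalanSimplex.{max u v} m} {i j k : Fin (n + 1)} (i' j' k' : Fin (m + 1))
    {hij : i ≤ j} {hjk : j ≤ k} (hij' : i' ≤ j') (hjk' : j' ≤ k')
    (h₁₂ : x.rel j k ↔ y.rel j' k') (h₀₂ : x.rel i k ↔ y.rel i' k')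
    (h₀₁ : x.rel i j ↔ y.rel i' j') :
    (value f x).triangle i j k hij hjk = (value f y).triangle i' j' k' hij' hjk' := by
  rw [value_triangle, value_triangle f y]
  congr 2
  apply catalan.rel_ext
  intro a b hab
  fin_cases a <;> fin_cases b
  all_goals first
    | exact absurd hab (by decide)
    | assumption

lemma value_edge_congr {n m : ℕ} {x : CatalanSimplex.{max u v} n}
    {y : CatalanSimplex.{max u v} m} {i j : Fin (n + 1)} (i' j' : Fin (m + 1))
    {hij : i ≤ j} (hij' : i' ≤ j') (h : x.rel i j ↔ y.rel i' j') :
    (value f x).edge i j hij = (value f y).edge i' j' hij' := by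
  refine congrArg Triangle.A₀₁ (value_triangle_congr f (x := x) (y := y) i' j' j' (hjk := le_rfl)
    hij' le_rfl ?_ h h)
  exact iff_of_false (fun h => lt_irrefl _ (x.lt_of_rel _ _ h))
    (fun h => lt_irrefl _ (y.lt_of_rel _ _ h))

lemma value_edge_of_not_rel {n : ℕ} {x : CatalanSimplex.{max u v} n} {i j : Fin (n + 1)}
    {hij : i ≤ j} (h : ¬ x.rel i j) : (value f x).edge i j hij = unitSemigroup C := by
  rw [value_edge_congr f (x := x) (y := x) i i le_rfl
    (iff_of_false h (fun h => lt_irrefl _ (x.lt_of_rel _ _ h)))]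
  exact (value f x).edge_self i

/-- A simplicial map from the Catalan simplicial set to `M` is determined by its values on the
non-degenerate simplices `α`, `τ` and `ε`. -/
lemma eq_of_value_eq {f g : catalan.{max u v} ⟶ M C}
    (hα : (value f catalan.α).edge 0 1 (by decide) = (value g catalan.α).edge 0 1 (by decide))
    (hτ : (value f catalan.τ).triangle 0 1 2 (by decide) (by decide) =
      (value g catalan.τ).triangle 0 1 2 (by decide) (by decide))
    (hε : (value f catalan.ε).triangle 0 1 2 (by decide) (by decide) =
      (value g catalan.ε).triangle 0 1 2 (by decide) (by decide)) : f = g := by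
  suffices h : ∀ n (x : CatalanSimplex.{max u v} n), value f x = value g x by
    ext n x
    exact h n.unop.len x
  intro n x
  apply MSimplex.ext_triangle
  intro i j k hij hjk
  rw [value_triangle f, value_triangle g]
  generalize (x.pullback _ : CatalanSimplex.{max u v} 2) = y
  have hα' : (value f catalan.α).triangle 0 0 1 (by decide) (by decide) =
      (value g catalan.α).triangle 0 0 1 (by decide) (by decide) :=
    ((value f _).face_left 0 1 _).trans
      ((congrArg (fun S => Triangle.mk _ _ _ (degen₀ S)) hα).trans
        ((value g _).face_left 0 1 _).symm)
  have hα'' : (value f catalan.α).triangle 0 1 1 (by decide) (by decide) =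
      (value g catalan.α).triangle 0 1 1 (by decide) (by decide) :=
    ((value f _).face_right 0 1 _).trans
      ((congrArg (fun S => Triangle.mk _ _ _ (degen₁ S)) hα).trans
        ((value g _).face_right 0 1 _).symm)
  have hpt : (value f catalan.pt).triangle 0 0 0 le_rfl le_rfl =
      (value g catalan.pt).triangle 0 0 0 le_rfl le_rfl :=
    ((value f _).face_left 0 0 _).trans
      ((congrArg (fun S => Triangle.mk _ _ _ (degen₀ S)) (((value f _).edge_self 0).trans
        ((value g _).edge_self 0).symm)).trans ((value g _).face_left 0 0 _).symm)
  rcases catalan.triangle_cases y with rfl | rfl | rfl | rfl | rfl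
  · refine ((value_triangle_congr f 0 0 0 le_rfl le_rfl ?_ ?_ ?_).trans hpt).trans
      (value_triangle_congr g 0 0 0 le_rfl le_rfl ?_ ?_ ?_).symm <;> exact Iff.rfl
  · refine ((value_triangle_congr f 0 0 1 _ _ ?_ ?_ ?_).trans hα').trans
      (value_triangle_congr g 0 0 1 _ _ ?_ ?_ ?_).symm <;> exact Iff.rfl
  · refine ((value_triangle_congr f 0 1 1 _ _ ?_ ?_ ?_).trans hα'').trans
      (value_triangle_congr g 0 1 1 _ _ ?_ ?_ ?_).symm <;> exact Iff.rfl
  · exact hτ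
  · exact hε

/-! ### The regular multiplier bimonoid of a simplicial map -/

/-- The compatibility conditions force the four components of a 2-simplex with boundary `{I, S, I}`
to come from a single morphism `S ⟶ I`. -/
lemma exists_counit {S : SemigroupObj C} (w : Filler (unitSemigroup C) S (unitSemigroup C)) :
    ∃ e : S.X ⟶ 𝟙_ C, w.φ = e ▷ 𝟙_ C ∧ w.ψ = 𝟙_ C ◁ e ∧ w.φ' = e ▷ 𝟙_ C ∧ w.ψ' = 𝟙_ C ◁ e := by
  have right : ∀ φ : S.X ⊗ 𝟙_ C ⟶ 𝟙_ C ⊗ 𝟙_ C, ∃ e : S.X ⟶ 𝟙_ C, φ = e ▷ 𝟙_ C :=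
    fun φ => ⟨(ρ_ _).inv ≫ φ ≫ (ρ_ _).hom, by simp⟩
  have left : ∀ ψ : 𝟙_ C ⊗ S.X ⟶ 𝟙_ C ⊗ 𝟙_ C, ∃ e : S.X ⟶ 𝟙_ C, ψ = 𝟙_ C ◁ e :=
    fun φ => ⟨(λ_ _).inv ≫ φ ≫ (λ_ _).hom, by simp⟩
  obtain ⟨e, he⟩ := right w.φ
  obtain ⟨e', he'⟩ := right w.φ'
  obtain ⟨d, hd⟩ := left w.ψ
  obtain ⟨d', hd'⟩ := left w.ψ'
  have key : ∀ {p q : S.X ⟶ 𝟙_ C},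
      𝟙_ C ◁ (p ▷ 𝟙_ C) ≫ (α_ (𝟙_ C) (𝟙_ C) (𝟙_ C)).inv ≫ (λ_ (𝟙_ C)).hom ▷ 𝟙_ C =
        (α_ (𝟙_ C) S.X (𝟙_ C)).inv ≫ (𝟙_ C ◁ q) ▷ 𝟙_ C ≫ (α_ (𝟙_ C) (𝟙_ C) (𝟙_ C)).hom ≫
          𝟙_ C ◁ (λ_ (𝟙_ C)).hom → p = q := by
    intro p q h
    have hp : 𝟙_ C ◁ (p ▷ 𝟙_ C) ≫ (α_ (𝟙_ C) (𝟙_ C) (𝟙_ C)).inv ≫ (λ_ (𝟙_ C)).hom ▷ 𝟙_ C =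
        𝟙_ C ◁ (p ▷ 𝟙_ C) ≫ (λ_ _).hom := by monoidal
    have hq : (α_ (𝟙_ C) S.X (𝟙_ C)).inv ≫ (𝟙_ C ◁ q) ▷ 𝟙_ C ≫
        (α_ (𝟙_ C) (𝟙_ C) (𝟙_ C)).hom ≫ 𝟙_ C ◁ (λ_ (𝟙_ C)).hom =
          𝟙_ C ◁ (q ▷ 𝟙_ C) ≫ (λ_ _).hom := by monoidal
    rw [hp, hq, cancel_mono] at h
    exact (whiskerRight_iff _ _).1 ((whiskerLeft_iff _ _).1 h)
  have h := w.unprimed.compat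
  have h₁ := w.compat₁
  have h₂ := w.compat₂
  rw [he, hd] at h
  rw [he, hd'] at h₁
  rw [hd, he'] at h₂
  simp only [← comp_whiskerRight, braiding_unit_inv_comp] at h₁
  simp only [← whiskerLeft_comp, braiding_unit_inv_comp] at h₂
  rw [← Iso.inv_comp_eq] at h₂
  obtain rfl := key h
  obtain rfl := key h₁
  obtain rfl := key h₂.symm
  exact ⟨e', he, hd, he', hd'⟩

/-- A criterion for `Corresponds` in terms of a semigroup `S` whose multiplication is only
propositionally equal to `R.mul`, whence the heterogeneous equalities. -/
lemma corresponds_of_heq {f : catalan.{max u v} ⟶ M C} {R : RegularMultiplierBimonoid C}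
    {S : SemigroupObj C} (hS : S = R.semigroup)
    (hα : (value f catalan.α).edge 0 1 (by decide) = S) (w : Filler S S S)
    (hw : (value f catalan.τ).triangle 0 1 2 (by decide) (by decide) = Triangle.mk _ _ _ w)
    (v : Filler (unitSemigroup C) S (unitSemigroup C))
    (hv : (value f catalan.ε).triangle 0 1 2 (by decide) (by decide) = Triangle.mk _ _ _ v)
    (h₁ : w.φ ≍ R.t₁) (h₂ : w.ψ ≍ R.t₂) (h₃ : w.φ' ≍ R.t₃) (h₄ : w.ψ' ≍ R.t₄)
    (e₁ : v.φ ≍ R.e ▷ 𝟙_ C) (e₂ : v.ψ ≍ 𝟙_ C ◁ R.e) (e₃ : v.φ' ≍ R.e ▷ 𝟙_ C)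
    (e₄ : v.ψ' ≍ 𝟙_ C ◁ R.e) : Corresponds f R := by
  subst hS
  exact ⟨R.mul_assoc, hα, ⟨w, hw, eq_of_heq h₁, eq_of_heq h₂, eq_of_heq h₃, eq_of_heq h₄⟩,
    ⟨v, hv, eq_of_heq e₁, eq_of_heq e₂, eq_of_heq e₃, eq_of_heq e₄⟩⟩

/-- Multiplicativity of the counit is not among the hypotheses: it is a consequence of the other
axioms of a multiplier bimonoid. -/
lemma exists_bimonoid {S : SemigroupObj C} (w : Filler S S S)
    (v : Filler (unitSemigroup C) S (unitSemigroup C)) (hw : IsTetrahedron w w w w)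
    (hl : IsTetrahedron (degen₀ S) w (degen₀ S) v)
    (hr : IsTetrahedron v (degen₁ S) w (degen₁ S)) :
    ∃ R : RegularMultiplierBimonoid C, S = R.semigroup ∧
      (w.φ ≍ R.t₁ ∧ w.ψ ≍ R.t₂ ∧ w.φ' ≍ R.t₃ ∧ w.ψ' ≍ R.t₄) ∧
      (v.φ ≍ R.e ▷ 𝟙_ C ∧ v.ψ ≍ 𝟙_ C ◁ R.e ∧ v.φ' ≍ R.e ▷ 𝟙_ C ∧ v.ψ' ≍ 𝟙_ C ◁ R.e) := by
  obtain ⟨e, e₁, e₂, e₃, e₄⟩ := exists_counit v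
  obtain ⟨⟨-, lr, li⟩, ⟨-, lr', li'⟩, -, -⟩ := hl
  obtain ⟨⟨rl, -, ri⟩, ⟨rl', -, ri'⟩, -, -⟩ := hr
  rw [e₂] at lr li
  rw [e₄] at lr' li'
  rw [e₁] at rl ri
  rw [e₃] at rl' ri'
  replace lr := fusionEquation₂_counit_left_iff.1 lr
  replace lr' := fusionEquation₂_counit_left_iff.1 lr'
  replace li := interchange_counit_left_iff.1 li
  replace li' := interchange_counit_left_iff.1 li'
  replace rl := fusionEquation₁_counit_right_iff.1 rl
  replace rl' := fusionEquation₁_counit_right_iff.1 rl'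
  replace ri := interchange_counit_right_iff.1 ri
  replace ri' := interchange_counit_right_iff.1 ri'
  refine ⟨{
    A := S.X
    t₁ := w.φ
    t₂ := w.ψ
    t₃ := w.φ'
    t₄ := w.ψ'
    e := e
    unprimed := ⟨hw.unprimed.left, rl, hw.unprimed.right, lr, ?_, li.trans ri.symm⟩
    primed := ⟨hw.primed.left, rl', hw.primed.right, lr', ?_, li'.trans ri'.symm⟩
    regular₁ := ?_
    regular₂ := ?_
    regular₃ := ?_
    regular₄ := ?_
    regular₅ := ?_ }, ?_, ⟨HEq.rfl, HEq.rfl, HEq.rfl, HEq.rfl⟩,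
      ⟨heq_of_eq e₁, heq_of_eq e₂, heq_of_eq e₃, heq_of_eq e₄⟩⟩
  · simpa using (hw.unprimed.interchange =≫ (α_ _ _ _).hom).symm
  · simpa using (hw.primed.interchange =≫ (α_ _ _ _).hom).symm
  · rw [← cancel_mono (λ_ S.X).hom]
    simp only [Category.assoc]
    rw [li, li']
    simp
  · rw [li]
    exact w.compat₃
  · simpa using hw.interchange₁ =≫ (α_ _ _ _).hom
  · rw [li]
    exact w.compat₄
  · simpa using ((α_ _ _ _).hom ≫= hw.interchange₂ =≫ (α_ _ _ _).hom).symm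
  · obtain ⟨X, m, ha⟩ := S
    simp only [RegularMultiplierBimonoid.semigroup, RegularMultiplierBimonoid.mul]
    congr 1
    exact li.symm

/-- The 3-simplex whose edges `02`, `03`, `13` and `23` are `α`. -/
def leftCounitSimplex : CatalanSimplex.{w} 3 where
  rel i j := (i = 0 ∧ 2 ≤ j) ∨ (i < 3 ∧ j = 3)
  lt_of_rel := by decide
  rel_left := by decide
  rel_right := by decide

/-- The 3-simplex whose edges `01`, `02`, `03` and `13` are `α`. -/
def rightCounitSimplex : CatalanSimplex.{w} 3 where
  rel i j := (i = 0 ∧ 0 < j) ∨ (i ≤ 1 ∧ j = 3)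
  lt_of_rel := by decide
  rel_left := by decide
  rel_right := by decide

/-- The 3-simplex all of whose edges are `α`. -/
def fusionSimplex : CatalanSimplex.{w} 3 where
  rel i j := i < j
  lt_of_rel := by decide
  rel_left := by decide
  rel_right := by decide

lemma exists_corresponds : ∃ R, Corresponds f R := by
  obtain ⟨S, hS⟩ : ∃ S, S = (value f catalan.α).edge 0 1 (by decide) := ⟨_, rfl⟩
  have h₀ : (value f catalan.α).triangle 0 0 1 (by decide) (by decide) =
      Triangle.mk _ _ _ (degen₀ S) := hS ▸ (value f _).face_left 0 1 _
  have h₁ : (value f catalan.α).triangle 0 1 1 (by decide) (by decide) =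
      Triangle.mk _ _ _ (degen₁ S) := hS ▸ (value f _).face_right 0 1 _
  have hτ : ∀ i j : Fin 3, ∀ h : i < j, (value f catalan.τ).edge i j h.le = S := fun i j h =>
    (value_edge_congr f (y := catalan.α) 0 1 (by decide)
      (iff_of_true h (by decide : (0 : Fin 2) < 1))).trans hS.symm
  obtain ⟨w, hw⟩ := ((value f catalan.τ).triangle 0 1 2 (by decide) (by decide)).exists_filler
    (hτ 1 2 (by decide)) (hτ 0 2 (by decide)) (hτ 0 1 (by decide))
  obtain ⟨v, hv⟩ := ((value f catalan.ε).triangle 0 1 2 (by decide) (by decide)).exists_filler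
    (value_edge_of_not_rel f (by simp [catalan.ε]))
    ((value_edge_congr f (y := catalan.α) 0 1 (by decide)
      (iff_of_true (by simp [catalan.ε]) (by simp [catalan.α]))).trans hS.symm)
    (value_edge_of_not_rel f (by simp [catalan.ε]))
  have tτ : IsTetrahedron w w w w := by
    refine ((value f fusionSimplex).tetrahedron 0 1 2 3 (by decide) (by decide) (by decide)).congr
      ((value_triangle_congr f 0 1 2 _ _ ?_ ?_ ?_).trans hw)
      ((value_triangle_congr f 0 1 2 _ _ ?_ ?_ ?_).trans hw)
      ((value_triangle_congr f 0 1 2 _ _ ?_ ?_ ?_).trans hw)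
      ((value_triangle_congr f 0 1 2 _ _ ?_ ?_ ?_).trans hw) <;>
    simp only [fusionSimplex, catalan.τ] <;> decide
  have tl : IsTetrahedron (degen₀ S) w (degen₀ S) v := by
    refine ((value f leftCounitSimplex).tetrahedron 0 1 2 3 (by decide) (by decide)
      (by decide)).congr
      ((value_triangle_congr f 0 0 1 _ _ ?_ ?_ ?_).trans h₀)
      ((value_triangle_congr f 0 1 2 _ _ ?_ ?_ ?_).trans hw)
      ((value_triangle_congr f 0 0 1 _ _ ?_ ?_ ?_).trans h₀)
      ((value_triangle_congr f 0 1 2 _ _ ?_ ?_ ?_).trans hv) <;>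
    simp only [leftCounitSimplex, catalan.α, catalan.τ, catalan.ε] <;> decide
  have tr : IsTetrahedron v (degen₁ S) w (degen₁ S) := by
    refine ((value f rightCounitSimplex).tetrahedron 0 1 2 3 (by decide) (by decide)
      (by decide)).congr
      ((value_triangle_congr f 0 1 2 _ _ ?_ ?_ ?_).trans hv)
      ((value_triangle_congr f 0 1 1 _ _ ?_ ?_ ?_).trans h₁)
      ((value_triangle_congr f 0 1 2 _ _ ?_ ?_ ?_).trans hw)
      ((value_triangle_congr f 0 1 1 _ _ ?_ ?_ ?_).trans h₁) <;>
    simp only [rightCounitSimplex, catalan.α, catalan.τ, catalan.ε] <;> decide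
  obtain ⟨R, hR, ⟨r₁, r₂, r₃, r₄⟩, r₅, r₆, r₇, r₈⟩ := exists_bimonoid w v tτ tl tr
  exact ⟨R, corresponds_of_heq hR hS.symm w hw v hv r₁ r₂ r₃ r₄ r₅ r₆ r₇ r₈⟩

lemma heq_of_triangle_eq {S S' : SemigroupObj C} {w : Filler S S S}
    {w' : Filler S' S' S'} (h : Triangle.mk _ _ _ w = Triangle.mk _ _ _ w') :
    w.φ ≍ w'.φ ∧ w.ψ ≍ w'.ψ ∧ w.φ' ≍ w'.φ' ∧ w.ψ' ≍ w'.ψ' := by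
  cases h
  simp

lemma heq_φ_of_triangle_eq {S S' : SemigroupObj C}
    {w : Filler (unitSemigroup C) S (unitSemigroup C)}
    {w' : Filler (unitSemigroup C) S' (unitSemigroup C)}
    (h : Triangle.mk _ _ _ w = Triangle.mk _ _ _ w') : w.φ ≍ w'.φ := by
  cases h
  rfl

lemma Corresponds.bimonoid_unique {f : catalan.{max u v} ⟶ M C}
    {R R' : RegularMultiplierBimonoid C} (h : Corresponds f R) (h' : Corresponds f R') :
    R = R' := by
  obtain ⟨_, hα, ⟨w, hw, h₁, h₂, h₃, h₄⟩, v, hv, e₁, -⟩ := h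
  obtain ⟨_, hα', ⟨w', hw', h₁', h₂', h₃', h₄'⟩, v', hv', e₁', -⟩ := h'
  have hS := hα.symm.trans hα'
  have hw := heq_of_triangle_eq (hw.symm.trans hw')
  have hv := heq_φ_of_triangle_eq (hv.symm.trans hv')
  rw [h₁, h₂, h₃, h₄, h₁', h₂', h₃', h₄'] at hw
  rw [e₁, e₁'] at hv
  obtain ⟨A, t₁, t₂, t₃, t₄, e, _, _, _, _, _, _, _⟩ := R
  obtain ⟨A', t₁', t₂', t₃', t₄', e', _, _, _, _, _, _, _⟩ := R'
  obtain rfl : A = A' := congrArg SemigroupObj.X hS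
  obtain ⟨k₁, k₂, k₃, k₄⟩ := hw
  obtain rfl : t₁ = t₁' := eq_of_heq k₁
  obtain rfl : t₂ = t₂' := eq_of_heq k₂
  obtain rfl : t₃ = t₃' := eq_of_heq k₃
  obtain rfl : t₄ = t₄' := eq_of_heq k₄
  obtain rfl : e = e' := by
    have h : e ▷ 𝟙_ C = e' ▷ 𝟙_ C := eq_of_heq hv
    simpa using h
  rfl

lemma Corresponds.map_unique {f g : catalan.{max u v} ⟶ M C}
    {R : RegularMultiplierBimonoid C} (h : Corresponds f R) (h' : Corresponds g R) :
    f = g := by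
  obtain ⟨_, hα, ⟨w, hw, h₁, h₂, h₃, h₄⟩, v, hv, e₁, e₂, e₃, e₄⟩ := h
  obtain ⟨_, hα', ⟨w', hw', h₁', h₂', h₃', h₄'⟩, v', hv', e₁', e₂', e₃', e₄'⟩ := h'
  obtain rfl : w = w' := Filler.ext (h₁.trans h₁'.symm) (h₂.trans h₂'.symm) (h₃.trans h₃'.symm)
    (h₄.trans h₄'.symm)
  obtain rfl : v = v' := Filler.ext (e₁.trans e₁'.symm) (e₂.trans e₂'.symm) (e₃.trans e₃'.symm)
    (e₄.trans e₄'.symm)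
  exact eq_of_value_eq (hα.trans hα'.symm) (hw.trans hw'.symm) (hv.trans hv'.symm)

end Maps

end Correspondence

end RegMult

theorem theorem3p5 {C : Type u} [Category.{v} C] [MonoidalCategory C] [BraidedCategory C] :
    ∃ Φ : (RegMult.catalan.{max u v} ⟶ RegMult.M C) ≃ RegMult.RegularMultiplierBimonoid C,
      ∀ f, RegMult.Corresponds f (Φ f) := by
  choose Φ hΦ using RegMult.exists_corresponds (C := C)
  exact ⟨⟨Φ, fun R => R.catalanData.toMap, fun f => (Φ f).corresponds_toMap.map_unique (hΦ f),
    fun R => (hΦ _).bimonoid_unique R.corresponds_toMap⟩, hΦ⟩
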